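/- Let $F$ be a field of characteristic different from $2$ which is either finite (with the discrete topology) or local non-archimedean, of residual characteristic $p$. Let $\mathcal{K}$ be $\mathbb{Q}(\zeta_p)$ if $F$ has positive characteristic and $\mathbb{Q}(\zeta_{p^\infty})$ if $F$ has characteristic $0$, and let $\mathcal{A}=\mathcal{O}_{\mathcal{K}}[1/p]$. Let $\psi:F\to\mathcal{A}^\times$ be a non-trivial smooth character, let $(W,\langle\,,\rangle)$ be a symplectic space of finite dimension over $F$, and let $H=W\times F$ be its Heisenberg group, with law $(w,t)(w',t')=(w+w',t+t'+\frac12\langle w,w'\rangle)$, on which $\mathrm{Sp}(W)$ acts by $g\cdot(w,t)=(gw,t)$. Let $\mathcal{B}$ be a commutative $\mathcal{A}$-algebra with structure morphism $\varphi$. A closed subgroup $A$ of $W$ is self-dual if $A=\{w\in W : \psi(\langle w,a\rangle)=1 \text{ for all } a\in A\}$. For such an $A$ and a smooth character $\psi_A:A_H=A\times F\to\mathcal{A}^\times$ extending $\psi$, set $V_A^{\mathcal{A}}=\mathrm{ind}_{A_H}^H(\psi_A)$ and $V_A^{\mathcal{B}}=\mathrm{ind}_{A_H}^H(\varphi\circ\psi_A)$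 (locally constant functions, compactly supported modulo $A_H$), on which $H$ acts by right translations. For $g\in\mathrm{Sp}(W)$ let $V_{gA}^{\mathcal{B}}$ be the module attached to $gA$ and to the character $\psi_{gA}(g\cdot a)=\psi_A(a)$, and let $I_g:V_A^{\mathcal{B}}\to V_{gA}^{\mathcal{B}}$, $(I_gf)(h)=f(g^{-1}\cdot h)$. Let $A$, $A'$ be self-dual subgroups of $W$ and $\psi_A$, $\psi_{A'}$ smooth characters extending $\psi$ as above. 1. For every $g\in\mathrm{Sp}(W)$, the automorphisms $J\circ I_g$ of $V_A^{\mathcal{B}}$, where $J$ runs over the isomorphisms of $\mathcal{B}[H]$-modules $V_{gA}^{\mathcal{B}}\to V_A^{\mathcal{B}}$, exist and define a single class $\sigma_A(g)$ in $\mathrm{PGL}_{\mathcal{B}}(V_A^{\mathcal{B}})=\mathrm{GL}_{\mathcal{B}}(V_A^{\mathcal{B}})/\mathcal{B}^\times$, and $\sigma_A:\mathrm{Sp}(W)\to\mathrm{PGL}_{\mathcal{B}}(V_A^{\mathcal{B}})$ is a group morphism. The fiber product $\widetilde{\mathrm{Sp}}_A=\mathrm{Sp}(W)\times_{\mathrm{PGL}_{\mathcal{B}}(V_A^{\mathcal{B}})}\mathrm{GL}_{\mathcal{B}}(V_A^{\mathcal{B}})$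 is a central extension of $\mathrm{Sp}(W)$ by $\mathcal{B}^\times$; its second projection $\omega_A:(g,M)\mapsto M$ is the Weil representation over $\mathcal{B}$ attached to $A$. The same holds for $A'$. 2. There exists an isomorphism of $\mathcal{A}[H]$-modules $\Phi:V_A^{\mathcal{A}}\to V_{A'}^{\mathcal{A}}$. For each such $\Phi$, the scalar extension of $\Phi$ to $\mathcal{B}$, i.e. the unique $\mathcal{B}$-linear map $\phi_{\mathcal{B}}(\Phi):V_A^{\mathcal{B}}\to V_{A'}^{\mathcal{B}}$ corresponding to $\mathrm{id}_{\mathcal{B}}\otimes\Phi$ through the canonical maps $\mathcal{B}\otimes_{\mathcal{A}}V_A^{\mathcal{A}}\to V_A^{\mathcal{B}}$ and $\mathcal{B}\otimes_{\mathcal{A}}V_{A'}^{\mathcal{A}}\to V_{A'}^{\mathcal{B}}$, $b\otimes f\mapsto b\,(\varphi\circ f)$, exists and is an isomorphism of $\mathcal{B}[H]$-modules. 3. For every isomorphism of $\mathcal{B}[H]$-modules $\Phi':V_A^{\mathcal{B}}\to V_{A'}^{\mathcal{B}}$ (for example $\Phi'=\phi_{\mathcal{B}}(\Phi)$), the map $(g,M)\mapsto(g,\Phi'M\Phi'^{-1})$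 is an isomorphism of central extensions from $\widetilde{\mathrm{Sp}}_A$ to $\widetilde{\mathrm{Sp}}_{A'}$ (a group isomorphism compatible with the projections to $\mathrm{Sp}(W)$ and with the inclusions of $\mathcal{B}^\times$), and for all $(g,M)\in\widetilde{\mathrm{Sp}}_A$ $$\Phi'\circ\omega_A((g,M))\circ\Phi'^{-1}=\omega_{A'}((g,\Phi'M\Phi'^{-1})).$$ In this sense the isomorphism class of the Weil representation over $\mathcal{B}$ does not depend on $A$. -/

import Mathlib

open scoped TensorProduct Pointwise

noncomputable section

namespace WeilRep

/-! ### The field and the coefficient ring -/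

/-- `F` is either a finite field of characteristic `p` with the discrete topology, or a local
non-archimedean field of residual characteristic `p` with its usual topology. -/
def IsFiniteOrLocalField (F : Type*) [Field F] [TopologicalSpace F] (p : ℕ) : Prop :=
  (Finite F ∧ DiscreteTopology F ∧ CharP F p) ∨
    ∃ _ : ValuativeRel F, IsNonarchimedeanLocalField F ∧
      CharP (IsLocalRing.ResidueField (ValuativeRel.valuation F).integer) p

/-- The orders of the roots of unity to be adjoined to `ℚ`: only `p` when `F` has positive
characteristic, all the powers of `p` when `F` has characteristic zero. -/
def rootOrders (F : Type*) [Field F] (p : ℕ) : Set ℕ :=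
  {n | (ringChar F ≠ 0 ∧ n = p) ∨ (ringChar F = 0 ∧ ∃ k : ℕ, n = p ^ k)}

/-- The ring `𝒜 = 𝓞_K[1/p]`, where `𝓞_K` is the integral closure of `ℤ` in `K`. -/
abbrev coeffRing (K : Type*) [Field K] (p : ℕ) : Subalgebra (integralClosure ℤ K) K :=
  Algebra.adjoin (integralClosure ℤ K) {((p : K))⁻¹}

/-! ### Compact induction of characters -/

section CompactInduction

variable {G : Type*} [Group G] [TopologicalSpace G] {R : Type*} [CommRing R]

/-- The compact induction `ind_S^G χ` of a character `χ : S → Rˣ`: the locally constant functions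
`f : G → R` with `f (s x) = χ s • f x` whose support is compact modulo `S`, i.e. contained in
`S C` for some compact subset `C` of `G`. -/
def cInd (S : Subgroup G) (χ : S →* Rˣ) : Submodule R (G → R) where
  carrier := {f | (∀ (s : S) (x : G), f (s * x) = (χ s : R) * f x) ∧ IsLocallyConstant f ∧
    ∃ C : Set G, IsCompact C ∧ Function.support f ⊆ (S : Set G) * C}
  zero_mem' := by
    refine ⟨fun s x => by simp, IsLocallyConstant.const 0, ∅, isCompact_empty, ?_⟩
    simp
  add_mem' := by
    rintro f g ⟨hf, hf', C, hC, hfC⟩ ⟨hg, hg', D, hD, hgD⟩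
    refine ⟨fun s x => by simp [hf, hg, mul_add], hf'.add hg', C ∪ D, hC.union hD, ?_⟩
    rw [Set.mul_union]
    exact (Function.support_add f g).trans (Set.union_subset_union hfC hgD)
  smul_mem' := by
    rintro c f ⟨hf, hf', C, hC, hfC⟩
    refine ⟨fun s x => ?_, hf'.comp (fun r => c • r), C, hC, ?_⟩
    · simp only [Pi.smul_apply, hf, smul_eq_mul]; ring
    · exact (Function.support_const_smul_subset c f).trans hfC

/-- The action of `G` on `ind_S^G χ` by right translations, `(g • f) x = f (x g)`. -/
def cIndRep [ContinuousMul G] (S : Subgroup G) (χ : S →* Rˣ) :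
    Representation R G (cInd S χ) where
  toFun g :=
    { toFun := fun f => ⟨fun x => f.1 (x * g), by
        obtain ⟨f, hf, hf', C, hC, hfC⟩ := f
        refine ⟨fun s x => ?_, hf'.comp_continuous (continuous_mul_const g), C * {g⁻¹},
          hC.mul isCompact_singleton, fun x hx => ?_⟩
        · simpa [mul_assoc] using hf s (x * g)
        · obtain ⟨s, hs, c, hc, h⟩ := hfC (show x * g ∈ Function.support f from hx)
          refine ⟨s, hs, c * g⁻¹, ⟨c, hc, g⁻¹, rfl, rfl⟩, ?_⟩
          change s * c = x * g at h
          change s * (c * g⁻¹) = x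
          rw [← mul_assoc, h, mul_inv_cancel_right]⟩
      map_add' := fun _ _ => rfl
      map_smul' := fun _ _ => rfl }
  map_one' := by ext f x; simp
  map_mul' g h := by ext f x; simp [mul_assoc]

/-- The canonical map `B ⊗_R ind_S^G χ → ind_S^G (φ ∘ χ)`, `b ⊗ f ↦ b • (φ ∘ f)`, for an
`R`-algebra `B` with structure morphism `φ`. -/
def scalarExt (S : Subgroup G) (χ : S →* Rˣ) (B : Type*) [CommRing B] [Algebra R B] :
    B ⊗[R] cInd S χ →ₗ[B] cInd S ((Units.map (algebraMap R B : R →* B)).comp χ) :=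
  LinearMap.liftBaseChange B
    { toFun := fun f => ⟨fun x => algebraMap R B (f.1 x), by
        obtain ⟨f, hf, hf', C, hC, hfC⟩ := f
        refine ⟨fun s x => by simp [hf], hf'.comp (algebraMap R B), C, hC, fun x hx => hfC ?_⟩
        intro h0
        exact hx (by simp [h0])⟩
      map_add' := fun f g => by ext x; simp
      map_smul' := fun r f => by ext x; simp [Algebra.smul_def] }

end CompactInduction

/-! ### The projective linear group and fiber products -/

section Projective

variable (R V : Type*) [CommRing R] [AddCommGroup V] [Module R V]

/-- The scalar automorphisms `v ↦ c • v`, `c ∈ Rˣ`. -/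
def scalars : Rˣ →* (V ≃ₗ[R] V) := DistribMulAction.toModuleAut R V

instance : (scalars R V).range.Normal where
  conj_mem := by
    rintro _ ⟨c, rfl⟩ M
    refine ⟨c, ?_⟩
    ext v
    simp [scalars, Units.smul_def, LinearEquiv.mul_apply]

/-- `PGL_R(V) = GL_R(V) / Rˣ`. -/
abbrev PGL := (V ≃ₗ[R] V) ⧸ (scalars R V).range

/-- The quotient morphism `GL_R(V) → PGL_R(V)`. -/
def red : (V ≃ₗ[R] V) →* PGL R V := QuotientGroup.mk' _

variable {R V} {G : Type*} [Group G]

/-- The fiber product of a projective representation `σ : G → PGL_R(V)` and of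
`red : GL_R(V) → PGL_R(V)`: the pairs `(g, M)` with `σ g = red M`. -/
def fiberProd (σ : G →* PGL R V) : Subgroup (G × (V ≃ₗ[R] V)) :=
  (σ.comp (MonoidHom.fst _ _)).eqLocus ((red R V).comp (MonoidHom.snd _ _))

/-- The first projection `(g, M) ↦ g` of the fiber product. -/
def fiberProd.proj (σ : G →* PGL R V) : fiberProd σ →* G :=
  (MonoidHom.fst _ _).comp (fiberProd σ).subtype

/-- The second projection `(g, M) ↦ M` of the fiber product. -/
def fiberProd.toGL (σ : G →* PGL R V) : fiberProd σ →* (V ≃ₗ[R] V) :=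
  (MonoidHom.snd _ _).comp (fiberProd σ).subtype

/-- The morphism `c ↦ (1, c • id)` from `Rˣ` to the fiber product. -/
def fiberProd.incl (σ : G →* PGL R V) : Rˣ →* fiberProd σ :=
  (MonoidHom.prod 1 (scalars R V)).codRestrict _ fun c => by
    change σ 1 = red R V (scalars R V c)
    rw [map_one, eq_comm]
    exact (QuotientGroup.eq_one_iff _).mpr ⟨c, rfl⟩

/-- `1 → N → E → G → 1` is a central extension, with maps `i` and `q`. -/
def IsCentralExtension {N E G : Type*} [Group N] [Group E] [Group G]
    (i : N →* E) (q : E →* G) : Prop :=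
  (∃ S : GroupExtension N E G, S.inl = i ∧ S.rightHom = q) ∧ i.range ≤ Subgroup.center E

end Projective

/-! ### The Heisenberg group and the symplectic group -/

section Heisenberg

variable {F W : Type*} [Field F] [AddCommGroup W] [Module F W]

/-- The set `W × F` underlying the Heisenberg group of a bilinear form `β` on `W`. -/
@[ext]
structure Heisenberg (β : LinearMap.BilinForm F W) where
  /-- the component in `W` -/
  w : W
  /-- the component in `F` -/
  t : F

variable {β : LinearMap.BilinForm F W}

/-- The law `(w, t) (w', t') = (w + w', t + t' + ½ β(w, w'))`. The last term of the inverse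
vanishes when `β` is alternating. -/
instance : Group (Heisenberg β) where
  mul x y := ⟨x.w + y.w, x.t + y.t + 2⁻¹ * β x.w y.w⟩
  one := ⟨0, 0⟩
  inv x := ⟨-x.w, -x.t + 2⁻¹ * β x.w x.w⟩
  mul_assoc x y z := by
    change Heisenberg.mk _ _ = Heisenberg.mk _ _
    ext
    · exact add_assoc _ _ _
    · change x.t + y.t + 2⁻¹ * β x.w y.w + z.t + 2⁻¹ * β (x.w + y.w) z.w =
        x.t + (y.t + z.t + 2⁻¹ * β y.w z.w) + 2⁻¹ * β x.w (y.w + z.w)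
      simp only [map_add, LinearMap.add_apply]
      ring
  one_mul x := by
    change Heisenberg.mk (0 + x.w) (0 + x.t + 2⁻¹ * β 0 x.w) = x
    ext <;> simp
  mul_one x := by
    change Heisenberg.mk (x.w + 0) (x.t + 0 + 2⁻¹ * β x.w 0) = x
    ext <;> simp
  inv_mul_cancel x := by
    change Heisenberg.mk (-x.w + x.w) (-x.t + 2⁻¹ * β x.w x.w + x.t + 2⁻¹ * β (-x.w) x.w) =
      Heisenberg.mk 0 0
    ext <;> simp

theorem Heisenberg.mul_w (x y : Heisenberg β) : (x * y).w = x.w + y.w := rfl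
theorem Heisenberg.mul_t (x y : Heisenberg β) :
    (x * y).t = x.t + y.t + 2⁻¹ * β x.w y.w := rfl
theorem Heisenberg.one_w : (1 : Heisenberg β).w = 0 := rfl
theorem Heisenberg.inv_w (x : Heisenberg β) : (x⁻¹).w = -x.w := rfl

/-- The product topology on the Heisenberg group. -/
instance [TopologicalSpace F] [TopologicalSpace W] : TopologicalSpace (Heisenberg β) :=
  TopologicalSpace.induced (fun x => (x.w, x.t)) inferInstance

theorem Heisenberg.continuous_pair [TopologicalSpace F] [TopologicalSpace W] :
    Continuous (fun x : Heisenberg β => (x.w, x.t)) :=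
  continuous_induced_dom

section Topology

variable [TopologicalSpace F] [TopologicalSpace W]

theorem Heisenberg.continuous_w : Continuous (Heisenberg.w : Heisenberg β → W) :=
  continuous_fst.comp Heisenberg.continuous_pair

theorem Heisenberg.continuous_t : Continuous (Heisenberg.t : Heisenberg β → F) :=
  continuous_snd.comp Heisenberg.continuous_pair

theorem Heisenberg.continuous_iff {X : Type*} [TopologicalSpace X] {f : X → Heisenberg β} :
    Continuous f ↔ Continuous (fun x => (f x).w) ∧ Continuous (fun x => (f x).t) :=
  continuous_induced_rng.trans
    ⟨fun h => ⟨continuous_fst.comp h, continuous_snd.comp h⟩, fun h => h.1.prodMk h.2⟩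

instance [IsTopologicalRing F] [FiniteDimensional F W] [IsModuleTopology F W] :
    ContinuousMul (Heisenberg β) where
  continuous_mul := by
    have := IsModuleTopology.toContinuousAdd F W
    have hb : Continuous (fun x : W × W => β x.1 x.2) :=
      IsModuleTopology.continuous_bilinear_of_finite_left β
    have hw := Heisenberg.continuous_w (β := β)
    have ht := Heisenberg.continuous_t (β := β)
    refine Heisenberg.continuous_iff.mpr ⟨?_, ?_⟩
    · exact (hw.comp continuous_fst).add (hw.comp continuous_snd)
    · refine ((ht.comp continuous_fst).add (ht.comp continuous_snd)).add
        (continuous_const.mul ?_)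
      exact hb.comp ((hw.comp continuous_fst).prodMk (hw.comp continuous_snd))

end Topology

/-- The subgroup `A_H = A × F` of the Heisenberg group. -/
def heisSub (β : LinearMap.BilinForm F W) (A : AddSubgroup W) : Subgroup (Heisenberg β) where
  carrier := {x | x.w ∈ A}
  mul_mem' hx hy := A.add_mem hx hy
  one_mem' := A.zero_mem
  inv_mem' hx := A.neg_mem hx

/-- The symplectic group: the `F`-linear automorphisms of `W` preserving the form. -/
def Sp (β : LinearMap.BilinForm F W) : Subgroup (W ≃ₗ[F] W) where
  carrier := {g | ∀ x y, β (g x) (g y) = β x y}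
  mul_mem' := by
    intro g h hg hh x y
    simp [LinearEquiv.mul_apply, hg (h x) (h y), hh x y]
  one_mem' x y := rfl
  inv_mem' := by
    intro g hg x y
    rw [← hg (g⁻¹ x) (g⁻¹ y), ← LinearEquiv.mul_apply, ← LinearEquiv.mul_apply, mul_inv_cancel]
    rfl

/-- The action `g • (w, t) = (g w, t)` of the symplectic group on the Heisenberg group. -/
def heisAct (g : Sp β) : Heisenberg β →* Heisenberg β where
  toFun x := ⟨g.1 x.w, x.t⟩
  map_one' := by
    change Heisenberg.mk (g.1 0) 0 = Heisenberg.mk 0 0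
    rw [map_zero]
  map_mul' x y := by
    change Heisenberg.mk (g.1 (x.w + y.w)) (x.t + y.t + 2⁻¹ * β x.w y.w) =
      Heisenberg.mk (g.1 x.w + g.1 y.w) (x.t + y.t + 2⁻¹ * β (g.1 x.w) (g.1 y.w))
    rw [map_add, g.2 x.w y.w]

theorem heisAct_inv_heisAct (g : Sp β) (x : Heisenberg β) : heisAct g⁻¹ (heisAct g x) = x := by
  have : (g⁻¹ * g : Sp β).1 x.w = x.w := by rw [inv_mul_cancel]; rfl
  exact Heisenberg.ext this rfl

theorem heisAct_heisAct_inv (g : Sp β) (x : Heisenberg β) : heisAct g (heisAct g⁻¹ x) = x := by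
  have : (g * g⁻¹ : Sp β).1 x.w = x.w := by rw [mul_inv_cancel]; rfl
  exact Heisenberg.ext this rfl

theorem continuous_heisAct [TopologicalSpace F] [IsTopologicalRing F] [TopologicalSpace W]
    [IsModuleTopology F W] (g : Sp β) : Continuous (heisAct g) := by
  have := IsModuleTopology.toContinuousAdd F W
  refine Heisenberg.continuous_iff.mpr ⟨?_, Heisenberg.continuous_t⟩
  exact (IsModuleTopology.continuous_of_linearMap g.1.toLinearMap).comp Heisenberg.continuous_w

/-- The translate `g A` of a subgroup `A` of `W`. -/
def translate (g : Sp β) (A : AddSubgroup W) : AddSubgroup W :=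
  A.map g.1.toLinearMap.toAddMonoidHom

theorem heisAct_mem_translate (g : Sp β) {A : AddSubgroup W} {x : Heisenberg β}
    (hx : x ∈ heisSub β A) : heisAct g x ∈ heisSub β (translate g A) :=
  ⟨x.w, hx, rfl⟩

theorem heisAct_inv_mem (g : Sp β) {A : AddSubgroup W} {x : Heisenberg β}
    (hx : x ∈ heisSub β (translate g A)) : heisAct g⁻¹ x ∈ heisSub β A := by
  obtain ⟨a, ha, h⟩ := hx
  have h1 : (g⁻¹ * g : Sp β).1 a = a := by rw [inv_mul_cancel]; rfl
  change (g⁻¹ : Sp β).1 x.w ∈ A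
  rw [← h]
  exact (h1.symm ▸ ha : (g⁻¹ * g : Sp β).1 a ∈ A)

variable {R : Type*} [CommRing R]

/-- The character `ψ_{gA}` of `(g A)_H` given by `ψ_{gA} (g • a) = ψ_A a` for `a` in `A_H`. -/
def translateChar (g : Sp β) {A : AddSubgroup W} (χ : heisSub β A →* Rˣ) :
    heisSub β (translate g A) →* Rˣ where
  toFun x := χ ⟨heisAct g⁻¹ x, heisAct_inv_mem g x.2⟩
  map_one' := by
    rw [← map_one χ]
    exact congrArg χ (Subtype.ext (map_one (heisAct g⁻¹)))
  map_mul' x y := by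
    rw [← map_mul χ]
    exact congrArg χ (Subtype.ext (map_mul (heisAct g⁻¹) _ _))

variable [TopologicalSpace F] [IsTopologicalRing F] [TopologicalSpace W] [IsModuleTopology F W]

/-- The bijection `I_g : V_A → V_{gA}`, `(I_g f) x = f (g⁻¹ • x)`. -/
def transport (g : Sp β) {A : AddSubgroup W} (χ : heisSub β A →* Rˣ) :
    cInd (heisSub β A) χ ≃ₗ[R] cInd (heisSub β (translate g A)) (translateChar g χ) where
  toFun f := ⟨fun x => f.1 (heisAct g⁻¹ x), by
    obtain ⟨f, hf, hf', C, hC, hfC⟩ := f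
    refine ⟨fun s x => ?_, hf'.comp_continuous (continuous_heisAct g⁻¹), heisAct g '' C,
      hC.image (continuous_heisAct g), fun x hx => ?_⟩
    · change f _ = _
      rw [map_mul]
      exact hf ⟨heisAct g⁻¹ s, heisAct_inv_mem g s.2⟩ _
    · obtain ⟨s, hs, c, hc, h⟩ := hfC (show heisAct g⁻¹ x ∈ Function.support f from hx)
      refine ⟨heisAct g s, heisAct_mem_translate g hs, heisAct g c, ⟨c, hc, rfl⟩, ?_⟩
      change heisAct g s * heisAct g c = x
      rw [← map_mul]
      change s * c = _ at h
      rw [h, heisAct_heisAct_inv]⟩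
  invFun f := ⟨fun x => f.1 (heisAct g x), by
    obtain ⟨f, hf, hf', C, hC, hfC⟩ := f
    refine ⟨fun s x => ?_, hf'.comp_continuous (continuous_heisAct g), heisAct g⁻¹ '' C,
      hC.image (continuous_heisAct g⁻¹), fun x hx => ?_⟩
    · change f _ = _
      rw [map_mul, hf ⟨heisAct g s, heisAct_mem_translate g s.2⟩]
      have h0 : translateChar g χ ⟨heisAct g s, heisAct_mem_translate g s.2⟩ = χ s :=
        congrArg χ (Subtype.ext (heisAct_inv_heisAct g _))
      rw [h0]
    · obtain ⟨s, hs, c, hc, h⟩ := hfC (show heisAct g x ∈ Function.support f from hx)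
      refine ⟨heisAct g⁻¹ s, heisAct_inv_mem g hs, heisAct g⁻¹ c, ⟨c, hc, rfl⟩, ?_⟩
      change heisAct g⁻¹ s * heisAct g⁻¹ c = x
      rw [← map_mul]
      change s * c = _ at h
      rw [h, heisAct_inv_heisAct]⟩
  map_add' _ _ := rfl
  map_smul' _ _ := rfl
  left_inv f := by
    ext x
    exact congrArg f.1 (heisAct_inv_heisAct g x)
  right_inv f := by
    ext x
    exact congrArg f.1 (heisAct_heisAct_inv g x)

end Heisenberg

/-! ### Self-dual subgroups, their models, and the Weil representation -/

section Weil

variable {F W : Type*} [Field F] [AddCommGroup W] [Module F W] [TopologicalSpace F]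
  [TopologicalSpace W] {R : Type*} [CommRing R]

/-- `A` is a closed subgroup of `W` with `A = {w | ψ (β(w, a)) = 1 for all a ∈ A}`. -/
def IsSelfDual (β : LinearMap.BilinForm F W) (ψ : AddChar F R) (A : AddSubgroup W) : Prop :=
  IsClosed (A : Set W) ∧ ∀ w : W, w ∈ A ↔ ∀ a ∈ A, ψ (β w a) = 1

/-- `ψA` is a smooth character of `A_H` extending the character `ψ` of the centre `F`. -/
def IsSmoothExtension {β : LinearMap.BilinForm F W} (ψ : AddChar F R) {A : AddSubgroup W}
    (ψA : heisSub β A →* Rˣ) : Prop :=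
  IsLocallyConstant ψA ∧ ∀ t : F, (ψA ⟨⟨0, t⟩, A.zero_mem⟩ : R) = ψ t

variable [IsTopologicalRing F] [FiniteDimensional F W] [IsModuleTopology F W]
  {β : LinearMap.BilinForm F W} {A : AddSubgroup W}

/-- The space `V_A = ind_{A_H}^H χ`. -/
abbrev Model (χ : heisSub β A →* Rˣ) : Type _ := cInd (heisSub β A) χ

/-- The action of the Heisenberg group on `V_A`. -/
abbrev modelRep (χ : heisSub β A →* Rˣ) : Representation R (Heisenberg β) (Model χ) :=
  cIndRep (heisSub β A) χ

/-- The character `χ^B = φ ∘ χ`, for an `R`-algebra `B` with structure morphism `φ`. -/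
abbrev charExt (B : Type*) [CommRing B] [Algebra R B] (χ : heisSub β A →* Rˣ) :
    heisSub β A →* Bˣ :=
  (Units.map (algebraMap R B : R →* B)).comp χ

/-- `σ : Sp(W) → PGL_R(V_A)` is the projective Weil representation: for all `g`, the set of
classes of the automorphisms `J ∘ I_g`, with `J` an isomorphism of `R[H]`-modules from
`V_{gA}` to `V_A`, is the singleton `{σ g}`. -/
def IsProjectiveWeil (χ : heisSub β A →* Rˣ) (σ : Sp β →* PGL R (Model χ)) : Prop :=
  ∀ g : Sp β, {P : PGL R (Model χ) |
      ∃ J : (modelRep (translateChar g χ)).Equiv (modelRep χ),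
        P = red R (Model χ) ((transport g χ).trans J.toLinearEquiv)} = {σ g}

/-- The metaplectic group attached to `σ`: the fiber product of `σ` and `red`. -/
abbrev Mp {χ : heisSub β A →* Rˣ} (σ : Sp β →* PGL R (Model χ)) :
    Subgroup (Sp β × (Model χ ≃ₗ[R] Model χ)) :=
  fiberProd σ

/-- The Weil representation `(g, M) ↦ M` of the metaplectic group attached to `σ`. -/
abbrev weil {χ : heisSub β A →* Rˣ} (σ : Sp β →* PGL R (Model χ)) :
    Mp σ →* (Model χ ≃ₗ[R] Model χ) :=
  fiberProd.toGL σ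

end Weil

end WeilRep

end

open scoped Topology

noncomputable section

namespace WeilRep

/-! ### Compact induction: eigenvectors and Frobenius reciprocity for open subgroups. -/

section CompactInduction

variable {G : Type*} [Group G] [TopologicalSpace G] {R : Type*} [CommRing R]

/-! This is a Stone–von Neumann argument with coefficients in a ring. On `V_A`, an element `(a, 0)`
with `a ∈ A` acts, up to a constant, as multiplication by `y ↦ ψ (β y.w a)`. The values of `ψ` are
roots of unity of `p`-power order and `p` is invertible, so each value other than `1` differs from
`1` by a unit, and Lagrange interpolation turns these multiplications into restriction to level
sets. Since `A` is its own orthogonal, such sets separate the cosets of `A_H`, and every stable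
submodule can be localized near a coset (`IsModel.exists_isCut`). Hence a stable submodule
containing a function with a unit value is everything (`IsModel.eq_top_of_isUnit`), and
endomorphisms are scalars (`IsModel.exists_eq_smul`). Only units and equalities `ψ x = 1` enter, so
all this survives the passage to `B` (`IsModel.baseChange`).

Two models are compared through `V_L` with `L` self-dual, compact and open. Frobenius reciprocity
turns an eigenvector of `L_H` in `V_A` with a value `1` into an isomorphism `V_L → V_A`
(`IsModel.frob_bijective`), given by the same formula over `𝒜` and over `B`. Such an `L` is `L₀ + (A
∩ L₀^⊥)` for a small `L₀` (`exists_open_isSelfDual`). The eigenvector exists because two extensions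
of `ψ` differ on `A ∩ L` by some `ψ (β w₀ ·)` (`exists_translation`), a duality for finite groups
carried out over the domain `𝒜`.

Finally `σ g = red M` holds exactly when `M` intertwines the Heisenberg action with its twist by `g`
(`IsProjectiveWeil.eq_red_iff`). Schur's lemma makes the class of `M` unique and `σ` multiplicative,
and conjugation by an isomorphism of models preserves the condition. -/

theorem cInd_apply_mul {S : Subgroup G} {χ : S →* Rˣ} (f : cInd S χ) (s : S) (x : G) :
    f.1 (s * x) = (χ s : R) * f.1 x :=
  f.2.1 s x

theorem isLocallyConstant_of_eq_one [ContinuousMul G] {S : Subgroup G} {M : Type*} [Group M]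
    (χ : S →* M) {U : Set G} (hU : U ∈ 𝓝 1) (h : ∀ s : S, (s : G) ∈ U → χ s = 1) :
    IsLocallyConstant χ := by
  rw [IsLocallyConstant.iff_eventually_eq]
  intro x
  have hc : Continuous (fun y : S => (x : G)⁻¹ * (y : G)) :=
    (continuous_const_mul _).comp continuous_subtype_val
  have h1 : Filter.Tendsto (fun y : S => (x : G)⁻¹ * (y : G)) (𝓝 x) (𝓝 1) := by
    have := hc.tendsto x
    simpa using this
  filter_upwards [h1 hU] with y hy
  have := h (x⁻¹ * y) hy
  rw [map_mul, map_inv, inv_mul_eq_one] at this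
  exact this.symm

theorem exists_nhds_eq_one {S : Subgroup G} {M : Type*} [Group M]
    {χ : S →* M} (hχ : IsLocallyConstant χ) :
    ∃ U ∈ 𝓝 (1 : G), ∀ s : S, (s : G) ∈ U → χ s = 1 := by
  have h := (IsLocallyConstant.iff_eventually_eq _).1 hχ 1
  rw [nhds_subtype_eq_comap, Filter.eventually_comap] at h
  exact ⟨_, h, fun s hs => (hs s rfl).trans (map_one χ)⟩

/-- The function on `S' x₀ S` with value `χ' a * χ s` at `a x₀ s` belongs to the compact
induction of `χ'`, and is an eigenvector of `S` with character `χ`. -/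
theorem exists_eigenvector [ContinuousMul G] {S' S : Subgroup G} (hS : IsOpen (S : Set G))
    (χ' : S' →* Rˣ) (χ : S →* Rˣ) (hχ : IsLocallyConstant χ) (x₀ : G) {C : Set G}
    (hC : IsCompact C) (hSC : ∀ s ∈ S, ∃ a ∈ S', ∃ c ∈ C, x₀ * s = a * c)
    (hcompat : ∀ (a : S') (s : S), (a : G) * x₀ = x₀ * s → χ' a = χ s) :
    ∃ v : cInd S' χ', v.1 x₀ = 1 ∧ (∀ s : S, cIndRep S' χ' s v = (χ s : R) • v) ∧
      ∀ x, v.1 x ≠ 0 → ∃ (a : S') (s : S), x = a * x₀ * s := by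
  classical
  let f : G → R := fun x => if h : ∃ p : S' × S, x = p.1 * x₀ * p.2 then
    (χ' h.choose.1 : R) * (χ h.choose.2 : R) else 0
  have hf (a : S') (s : S) : f (a * x₀ * s) = χ' a * χ s := by
    have h : ∃ p : S' × S, (a * x₀ * s : G) = p.1 * x₀ * p.2 := ⟨(a, s), rfl⟩
    have h' := h.choose_spec
    simp only [f, dif_pos h]
    generalize h.choose = p at h'
    -- Two presentations `a x₀ s = p₁ x₀ p₂` of a point give `(p₁⁻¹ a) x₀ = x₀ (p₂ s⁻¹)`, where the
    -- two characters agree; so the value does not depend on the choice.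
    have h1 := hcompat (p.1⁻¹ * a) (p.2 * s⁻¹) (by
      push_cast
      rw [← mul_assoc, eq_mul_inv_iff_mul_eq, mul_assoc, mul_assoc, inv_mul_eq_iff_eq_mul,
        ← mul_assoc, h', ← mul_assoc])
    rw [map_mul, map_mul, map_inv, map_inv, inv_mul_eq_iff_eq_mul, ← mul_assoc,
      eq_mul_inv_iff_mul_eq] at h1
    exact_mod_cast h1.symm
  have hf0 (x : G) (hx : ¬ ∃ p : S' × S, x = p.1 * x₀ * p.2) : f x = 0 := dif_neg hx
  have hl (a : S') (x : G) : f (a * x) = χ' a * f x := by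
    by_cases h : ∃ p : S' × S, x = p.1 * x₀ * p.2
    · obtain ⟨p, rfl⟩ := h
      rw [hf, show (a * (p.1 * x₀ * p.2) : G) = (a * p.1 : S') * x₀ * p.2 by
        push_cast; simp only [mul_assoc], hf, map_mul]
      push_cast; ring
    · rw [hf0 x h, mul_zero]
      refine hf0 _ fun ⟨p, hp⟩ => h ⟨(a⁻¹ * p.1, p.2), ?_⟩
      push_cast
      rw [mul_assoc, mul_assoc, ← mul_assoc (p.1 : G), ← hp, inv_mul_cancel_left]
  have hr (s : S) (x : G) : f (x * s) = χ s * f x := by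
    by_cases h : ∃ p : S' × S, x = p.1 * x₀ * p.2
    · obtain ⟨p, rfl⟩ := h
      rw [hf, show (p.1 * x₀ * p.2 * s : G) = p.1 * x₀ * (p.2 * s : S) by
        push_cast; simp only [mul_assoc], hf, map_mul]
      push_cast; ring
    · rw [hf0 x h, mul_zero]
      refine hf0 _ fun ⟨p, hp⟩ => h ⟨(p.1, p.2 * s⁻¹), ?_⟩
      push_cast
      rw [← mul_assoc, ← hp, mul_inv_cancel_right]
  refine ⟨⟨f, hl, ?_, C, hC, ?_⟩, ?_, ?_, ?_⟩
  -- Local constancy comes from the right: `f (x u) = χ u * f x` for `u` in the open subgroup `S`,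
  -- and `χ u = 1` near `1`. No smoothness of `χ'` is needed.
  · rw [IsLocallyConstant.iff_eventually_eq]
    intro x
    obtain ⟨U, hU, h1⟩ := exists_nhds_eq_one hχ
    have hc : Filter.Tendsto (fun y : G => x⁻¹ * y) (𝓝 x) (𝓝 1) := by
      simpa using (continuous_const_mul x⁻¹).tendsto x
    filter_upwards [hc hU, hc (hS.mem_nhds S.one_mem)] with y hy hy'
    have := hr ⟨x⁻¹ * y, hy'⟩ x
    rw [h1 ⟨x⁻¹ * y, hy'⟩ hy] at this
    simpa using this
  · intro x hx
    by_contra h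
    refine hx (hf0 x fun ⟨p, hp⟩ => h ?_)
    obtain ⟨a, ha, c, hc, h'⟩ := hSC p.2 p.2.2
    refine ⟨p.1 * a, S'.mul_mem p.1.2 ha, c, hc, ?_⟩
    change (p.1 * a * c : G) = x
    rw [hp, mul_assoc, mul_assoc, h']
  · have := hf 1 1
    simpa using this
  · intro s
    ext x
    exact hr s x
  · intro x hx
    by_contra h
    refine hx (hf0 x fun ⟨p, hp⟩ => h ⟨p.1, p.2, hp⟩)

section Frobenius

variable {S : Subgroup G} {χ : S →* Rˣ} {V : Type*} [AddCommGroup V] [Module R V]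
  (ρ : Representation R G V) {v : V}

/-- The function `x S ↦ f(x⁻¹) • ρ x v`, for an eigenvector `v` of `S`. -/
def frobTerm (hv : ∀ s : S, ρ s v = (χ s : R) • v) (f : cInd S χ) : G ⧸ S → V :=
  Quotient.lift (fun x : G => f.1 x⁻¹ • ρ x v) fun x y hxy => by
    obtain ⟨s, rfl⟩ : ∃ s : S, y = x * s :=
      ⟨⟨x⁻¹ * y, QuotientGroup.leftRel_apply.1 hxy⟩, by simp⟩
    have h : f.1 (x * s)⁻¹ = ((χ s)⁻¹ : Rˣ) * f.1 x⁻¹ := by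
      rw [mul_inv_rev, ← map_inv]
      exact cInd_apply_mul f s⁻¹ x⁻¹
    change _ = f.1 (x * s)⁻¹ • ρ (x * s) v
    rw [h, map_mul, Module.End.mul_apply, hv, map_smul, smul_smul, mul_right_comm, Units.inv_mul,
      one_mul]

variable (hv : ∀ s : S, ρ s v = (χ s : R) • v)

theorem frobTerm_mk (f : cInd S χ) (x : G) :
    frobTerm ρ hv f (x : G ⧸ S) = f.1 x⁻¹ • ρ x v := rfl

variable [ContinuousMul G]

/-- The support of `f` is compact modulo `S`, and the cosets of the open subgroup `S` are open, so
finitely many of them cover it. -/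
theorem finite_support_frobTerm (hS : IsOpen (S : Set G)) (f : cInd S χ) :
    (Function.support (frobTerm ρ hv f)).Finite := by
  obtain ⟨C, hC, hfC⟩ := f.2.2.2
  have h : ∃ T : Set (G ⧸ S), T.Finite ∧ ∀ c ∈ C, ((c⁻¹ : G) : G ⧸ S) ∈ T := by
    refine hC.induction_on (p := fun D => ∃ T : Set (G ⧸ S), T.Finite ∧
      ∀ c ∈ D, ((c⁻¹ : G) : G ⧸ S) ∈ T) ⟨∅, Set.finite_empty, by simp⟩ ?_ ?_ ?_
    · rintro s t hst ⟨T, hT, h⟩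
      exact ⟨T, hT, fun c hc => h c (hst hc)⟩
    · rintro s t ⟨T, hT, h⟩ ⟨T', hT', h'⟩
      exact ⟨T ∪ T', hT.union hT', fun c hc => hc.elim (fun hc => Or.inl (h c hc))
        fun hc => Or.inr (h' c hc)⟩
    · intro c hc
      refine ⟨(S : Set G) * {c}, mem_nhdsWithin_of_mem_nhds
        (hS.mul_right.mem_nhds ⟨1, S.one_mem, c, rfl, one_mul c⟩), {((c⁻¹ : G) : G ⧸ S)},
        Set.finite_singleton _, ?_⟩
      rintro _ ⟨s, hs, _, rfl, rfl⟩
      rw [Set.mem_singleton_iff, QuotientGroup.eq]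
      simpa using hs
  obtain ⟨T, hT, h⟩ := h
  refine hT.subset fun q hq => ?_
  induction q using QuotientGroup.induction_on with
  | H x =>
    have hx : f.1 x⁻¹ ≠ 0 := fun h0 => hq (by rw [frobTerm_mk, h0, zero_smul])
    obtain ⟨s, hs, c, hc, hsc⟩ := hfC hx
    change s * c = x⁻¹ at hsc
    convert h c hc using 1
    rw [QuotientGroup.eq, ← hsc, mul_assoc, mul_inv_cancel, mul_one]
    exact hs

/-- Frobenius reciprocity: the morphism `ind_S^G χ → V` attached to an eigenvector `v` of the open
subgroup `S`. -/
def frob (hS : IsOpen (S : Set G)) : cInd S χ →ₗ[R] V where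
  toFun f := ∑ᶠ q, frobTerm ρ hv f q
  map_add' f g := by
    rw [← finsum_add_distrib (finite_support_frobTerm ρ hv hS f)
      (finite_support_frobTerm ρ hv hS g)]
    refine finsum_congr fun q => ?_
    induction q using QuotientGroup.induction_on with
    | H x => simp [frobTerm_mk, add_smul]
  map_smul' c f := by
    rw [RingHom.id_apply, smul_finsum' c (finite_support_frobTerm ρ hv hS f)]
    refine finsum_congr fun q => ?_
    induction q using QuotientGroup.induction_on with
    | H x => simp [frobTerm_mk, mul_smul]

theorem frob_apply (hS : IsOpen (S : Set G)) (f : cInd S χ) :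
    frob ρ hv hS f = ∑ᶠ q, frobTerm ρ hv f q := rfl

theorem frob_cIndRep (hS : IsOpen (S : Set G)) (g : G) (f : cInd S χ) :
    frob ρ hv hS (cIndRep S χ g f) = ρ g (frob ρ hv hS f) := by
  rw [frob_apply, frob_apply, map_finsum (ρ g) (finite_support_frobTerm ρ hv hS f)]
  refine finsum_eq_of_bijective (fun q => g⁻¹ • q) (MulAction.bijective g⁻¹) fun q => ?_
  induction q using QuotientGroup.induction_on with
  | H x =>
    change f.1 (x⁻¹ * g) • ρ x v = ρ g (f.1 (g⁻¹ * x)⁻¹ • ρ (g⁻¹ * x) v)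
    rw [map_smul, ← Module.End.mul_apply, ← map_mul, mul_inv_cancel_left, mul_inv_rev, inv_inv]

theorem frob_of_support_subset (hS : IsOpen (S : Set G)) (f : cInd S χ)
    (hf : Function.support f.1 ⊆ S) : frob ρ hv hS f = f.1 1 • v := by
  rw [frob_apply, finsum_eq_single _ ((1 : G) : G ⧸ S)]
  · rw [frobTerm_mk, inv_one, map_one, Module.End.one_apply]
  · intro q hq
    induction q using QuotientGroup.induction_on with
    | H x =>
      rw [frobTerm_mk]
      by_cases h : f.1 x⁻¹ = 0
      · rw [h, zero_smul]
      · exact absurd (QuotientGroup.eq.2 (by simpa using hf h)) hq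

end Frobenius

end CompactInduction

/-! ### Localization of stable submodules and Schur's lemma. -/

section Cut

variable {F W : Type*} [Field F] [AddCommGroup W] [Module F W]
  {β : LinearMap.BilinForm F W} {A : AddSubgroup W} {R : Type*} [CommRing R] {ψ : AddChar F R}

section Algebra

theorem Heisenberg.mul_mk_of_isAlt (h2 : (2 : F) ≠ 0) (hβ : β.IsAlt) (y : Heisenberg β) (a : W) :
    y * ⟨a, 0⟩ = (⟨a, β y.w a⟩ : Heisenberg β) * y := by
  refine Heisenberg.ext (add_comm _ _) ?_
  change y.t + 0 + 2⁻¹ * β y.w a = β y.w a + y.t + 2⁻¹ * β a y.w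
  rw [← hβ.neg_eq a y.w]
  field_simp
  ring

theorem Heisenberg.mk_mul_mk_zero (a : W) (s t : F) :
    (⟨a, s⟩ : Heisenberg β) * ⟨0, t⟩ = ⟨a, s + t⟩ := by
  refine Heisenberg.ext (add_zero _) ?_
  change s + t + 2⁻¹ * β a 0 = s + t
  simp

theorem Heisenberg.mk_zero_mul_mk (a : W) (s t : F) :
    (⟨0, t⟩ : Heisenberg β) * ⟨a, s⟩ = ⟨a, t + s⟩ := by
  refine Heisenberg.ext (zero_add _) ?_
  change t + s + 2⁻¹ * β 0 a = t + s
  simp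

end Algebra

variable [TopologicalSpace F] [TopologicalSpace W]

theorem IsSmoothExtension.apply_mk {χ : heisSub β A →* Rˣ} (hχ : IsSmoothExtension ψ χ) {a : W}
    (ha : a ∈ A) (s t : F) : (χ ⟨⟨a, s + t⟩, ha⟩ : R) = χ ⟨⟨a, s⟩, ha⟩ * ψ t := by
  rw [← hχ.2, ← Units.val_mul, ← map_mul]
  congr 2
  exact Subtype.ext (Heisenberg.mk_mul_mk_zero a s t).symm

theorem IsSmoothExtension.apply_mk_zero {χ : heisSub β A →* Rˣ} (hχ : IsSmoothExtension ψ χ) {a : W}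
    (ha : a ∈ A) (t : F) : (χ ⟨⟨a, t⟩, ha⟩ : R) = χ ⟨⟨a, 0⟩, ha⟩ * ψ t := by
  rw [← hχ.apply_mk, zero_add]

/-- The hypotheses under which the model `V_A` attached to `χ` is well behaved over an arbitrary
ring of coefficients: the values of `ψ` other than `1` differ from `1` by a unit, and `A` is its
own orthogonal for `ψ ∘ β`, in a sense which is stable under extension of scalars. -/
structure IsModel (β : LinearMap.BilinForm F W) (ψ : AddChar F R) {A : AddSubgroup W}
    (χ : heisSub β A →* Rˣ) : Prop where
  two_ne : (2 : F) ≠ 0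
  alt : β.IsAlt
  smooth : IsLocallyConstant ψ
  unit : ∀ x, ψ x = 1 ∨ IsUnit (ψ x - 1)
  isotropic : ∀ a ∈ A, ∀ b ∈ A, ψ (β a b) = 1
  separates : ∀ w ∉ A, ∃ a ∈ A, IsUnit (ψ (β w a) - 1)
  ext : IsSmoothExtension ψ χ

theorem IsModel.pairing_mul {χ : heisSub β A →* Rˣ} (hm : IsModel β ψ χ) (w : W) {a : W}
    (ha : a ∈ A) {s : Heisenberg β} (hs : s ∈ heisSub β A) (y : Heisenberg β) :
    ψ (β ((s * y).w - w) a) = ψ (β (y.w - w) a) := by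
  rw [Heisenberg.mul_w, add_sub_assoc, map_add, LinearMap.add_apply, AddChar.map_add_eq_mul,
    hm.isotropic _ hs _ ha, one_mul]

variable [IsTopologicalRing F] [IsModuleTopology F W]

theorem isLocallyConstant_pairing (hψ : IsLocallyConstant ψ) (w a : W) :
    IsLocallyConstant (fun y : Heisenberg β => ψ (β (y.w - w) a)) := by
  have := IsModuleTopology.topologicalAddGroup F W
  have h : Continuous (fun x : W => β (x - w) a) :=
    (IsModuleTopology.continuous_of_linearMap (β.flip a)).comp (continuous_sub_right w)
  exact hψ.comp_continuous (h.comp Heisenberg.continuous_w)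

variable [FiniteDimensional F W]
  {χ : heisSub β A →* Rˣ}

/-- Commutators are central, so right translation by `(a, 0)` is left multiplication by `(a, β y.w
a) ∈ A_H`, on which the equivariance of `f` applies. This is the source of all the multiplication
operators. -/
theorem IsModel.cIndRep_apply (hm : IsModel β ψ χ) {a : W} (ha : a ∈ A) (f : Model χ)
    (y : Heisenberg β) :
    (modelRep χ ⟨a, 0⟩ f).1 y = (χ ⟨⟨a, 0⟩, ha⟩ : R) * ψ (β y.w a) * f.1 y := by
  change f.1 (y * ⟨a, 0⟩) = _
  rw [Heisenberg.mul_mk_of_isAlt hm.two_ne hm.alt]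
  exact (cInd_apply_mul f ⟨⟨a, β y.w a⟩, ha⟩ y).trans (by rw [hm.ext.apply_mk_zero])

/-- The functions `m` such that `M` is stable under multiplication by `m` on both components. -/
def multipliers (M : Submodule R (Model χ × Model χ)) : Subalgebra R (Heisenberg β → R) where
  carrier := {m | ∀ p ∈ M, ∃ q ∈ M, q.1.1 = m * p.1.1 ∧ q.2.1 = m * p.2.1}
  mul_mem' := by
    intro m m' hm hm' p hp
    obtain ⟨q, hq, h1, h2⟩ := hm' p hp
    obtain ⟨r, hr, h3, h4⟩ := hm q hq
    exact ⟨r, hr, by rw [h3, h1, mul_assoc], by rw [h4, h2, mul_assoc]⟩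
  add_mem' := by
    intro m m' hm hm' p hp
    obtain ⟨q, hq, h1, h2⟩ := hm p hp
    obtain ⟨r, hr, h3, h4⟩ := hm' p hp
    exact ⟨q + r, M.add_mem hq hr, by rw [add_mul, ← h1, ← h3]; rfl,
      by rw [add_mul, ← h2, ← h4]; rfl⟩
  algebraMap_mem' c p hp :=
    ⟨c • p, M.smul_mem c hp, by ext y; rfl, by ext y; rfl⟩

/-- Stability under the diagonal action of the Heisenberg group. -/
def IsStable (M : Submodule R (Model χ × Model χ)) : Prop :=
  ∀ h, ∀ p ∈ M, (modelRep χ h p.1, modelRep χ h p.2) ∈ M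

/-- A clopen left `A_H`-invariant set `S` such that restriction of functions to `S` followed by
extension by zero preserves the stable submodules. -/
structure IsCut (χ : heisSub β A →* Rˣ) (S : Set (Heisenberg β)) : Prop where
  isClopen : IsClopen S
  invariant : ∀ a ∈ heisSub β A, ∀ y, a * y ∈ S ↔ y ∈ S
  restrict : ∀ M : Submodule R (Model χ × Model χ), IsStable M → ∀ p ∈ M,
    ∃ q ∈ M, q.1.1 = S.indicator p.1.1 ∧ q.2.1 = S.indicator p.2.1

theorem IsCut.compl {S : Set (Heisenberg β)} (hS : IsCut χ S) : IsCut χ Sᶜ where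
  isClopen := hS.isClopen.compl
  invariant a ha y := not_congr (hS.invariant a ha y)
  restrict M hM p hp := by
    obtain ⟨q, hq, h1, h2⟩ := hS.restrict M hM p hp
    refine ⟨p - q, M.sub_mem hp hq, ?_, ?_⟩
    · rw [Set.indicator_compl, ← h1]; rfl
    · rw [Set.indicator_compl, ← h2]; rfl

theorem IsCut.inter {S S' : Set (Heisenberg β)} (hS : IsCut χ S) (hS' : IsCut χ S') :
    IsCut χ (S ∩ S') where
  isClopen := hS.isClopen.inter hS'.isClopen
  invariant a ha y := and_congr (hS.invariant a ha y) (hS'.invariant a ha y)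
  restrict M hM p hp := by
    obtain ⟨q, hq, h1, h2⟩ := hS'.restrict M hM p hp
    obtain ⟨r, hr, h3, h4⟩ := hS.restrict M hM q hq
    exact ⟨r, hr, by rw [h3, h1, Set.indicator_indicator], by rw [h4, h2, Set.indicator_indicator]⟩

theorem IsCut.union {S S' : Set (Heisenberg β)} (hS : IsCut χ S) (hS' : IsCut χ S') :
    IsCut χ (S ∪ S') := by
  simpa [Set.compl_inter] using (hS.compl.inter hS'.compl).compl

variable (χ) in
theorem IsCut.univ : IsCut χ Set.univ :=
  ⟨isClopen_univ, fun _ _ _ => by simp, fun M _ p hp => ⟨p, hp, by simp, by simp⟩⟩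

variable (χ) in
theorem IsCut.empty : IsCut χ ∅ := by
  simpa using (IsCut.univ χ).compl

/-- The operator is the action of `(a, 0)`, rescaled by the unit `χ (a, 0)⁻¹` and by `ψ (-β w a)`,
which centres the character at `w`. -/
theorem IsModel.pairing_mem_multipliers (hm : IsModel β ψ χ) {M : Submodule R (Model χ × Model χ)}
    (hM : IsStable M) (w : W) {a : W} (ha : a ∈ A) :
    (fun y : Heisenberg β => ψ (β (y.w - w) a)) ∈ multipliers M := by
  intro p hp
  have key (f : Model χ) : ((((χ ⟨⟨a, 0⟩, ha⟩)⁻¹ : Rˣ) * ψ (-β w a) : R) •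
      modelRep χ ⟨a, 0⟩ f).1 = (fun y : Heisenberg β => ψ (β (y.w - w) a)) * f.1 := by
    ext y
    change ((((χ ⟨⟨a, 0⟩, ha⟩)⁻¹ : Rˣ) : R) * ψ (-β w a)) * (modelRep χ ⟨a, 0⟩ f).1 y =
      ψ (β (y.w - w) a) * f.1 y
    rw [hm.cIndRep_apply ha, map_sub, LinearMap.sub_apply, sub_eq_add_neg, AddChar.map_add_eq_mul]
    linear_combination (ψ (-β w a) * ψ (β y.w a) * f.1 y) * (χ ⟨⟨a, 0⟩, ha⟩).inv_mul
  exact ⟨_, M.smul_mem (((χ ⟨⟨a, 0⟩, ha⟩)⁻¹ : Rˣ) * ψ (-β w a)) (hM ⟨a, 0⟩ p hp), key _, key _⟩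

theorem _root_.IsLocallyConstant.finite_image {X Y : Type*} [TopologicalSpace X] {f : X → Y}
    (hf : IsLocallyConstant f) {C : Set X} (hC : IsCompact C) : (f '' C).Finite := by
  let : TopologicalSpace Y := ⊥
  have : DiscreteTopology Y := ⟨rfl⟩
  exact (hC.image hf.continuous).finite_of_discrete

/-- On the supports of a given pair, the indicator function of the level set is a polynomial in the
multiplier `y ↦ ψ (β (y.w - w) a)`, by Lagrange interpolation. -/
theorem IsModel.isCut_pairing (hm : IsModel β ψ χ) (w : W) {a : W} (ha : a ∈ A) :
    IsCut χ {y | ψ (β (y.w - w) a) = 1} where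
  isClopen := (isLocallyConstant_pairing hm.smooth w a).isClopen_fiber 1
  invariant s hs y := by simp only [Set.mem_ofPred_eq, hm.pairing_mul w ha hs]
  restrict M hM p hp := by
    classical
    obtain ⟨C, hC, hpC⟩ := p.1.2.2.2
    obtain ⟨D, hD, hpD⟩ := p.2.2.2.2
    let θ : Heisenberg β → R := fun y => ψ (β (y.w - w) a)
    have hfin := (isLocallyConstant_pairing hm.smooth w a).finite_image (hC.union hD)
    -- The values other than `1` taken by `θ` on `C ∪ D`; by left invariance under `A_H` these are
    -- all its values other than `1` on `A_H (C ∪ D)`, which contains both supports.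
    let Z : Finset R := hfin.toFinset.erase 1
    -- The Lagrange polynomial with value `1` at `1` and `0` on `Z`. By `hu` below, `Ring.inverse`
    -- is evaluated only at units and is a true inverse.
    let m : Heisenberg β → R := ∏ ζ ∈ Z, Ring.inverse (1 - ζ) • (θ - algebraMap R _ ζ)
    have hmm : m ∈ multipliers M :=
      prod_mem fun ζ _ => Subalgebra.smul_mem _ (sub_mem (hm.pairing_mem_multipliers hM w ha)
        (Subalgebra.algebraMap_mem _ ζ)) _
    have hval (y) : m y = ∏ ζ ∈ Z, Ring.inverse (1 - ζ) * (θ y - ζ) := by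
      simp only [m, Finset.prod_apply]; rfl
    have hu (ζ) (hζ : ζ ∈ Z) : IsUnit (1 - ζ) := by
      obtain ⟨h1, h2⟩ := Finset.mem_erase.1 hζ
      obtain ⟨y, -, rfl⟩ := hfin.mem_toFinset.1 h2
      exact neg_sub (θ y) 1 ▸ ((hm.unit _).resolve_left h1).neg
    have key (f : Model χ) (h : Function.support f.1 ⊆ (heisSub β A : Set _) * (C ∪ D)) :
        m * f.1 = Set.indicator {y | θ y = 1} f.1 := by
      ext y
      by_cases hy : y ∈ {y | θ y = 1}
      · rw [Set.indicator_of_mem hy, Pi.mul_apply, hval, Finset.prod_eq_one, one_mul]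
        intro ζ hζ
        rw [show θ y = 1 from hy, Ring.inverse_mul_cancel _ (hu ζ hζ)]
      · rw [Set.indicator_of_notMem hy, Pi.mul_apply]
        by_cases hf : f.1 y = 0
        · rw [hf, mul_zero]
        · obtain ⟨s, hs, c, hc, rfl⟩ := h hf
          rw [hval, Finset.prod_eq_zero (i := θ (s * c)), zero_mul]
          · refine Finset.mem_erase.2 ⟨hy, hfin.mem_toFinset.2 ⟨c, hc, ?_⟩⟩
            exact (hm.pairing_mul w ha hs c).symm
          · rw [sub_self, mul_zero]
    obtain ⟨q, hq, h1, h2⟩ := hmm p hp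
    refine ⟨q, hq, h1.trans (key _ (hpC.trans ?_)), h2.trans (key _ (hpD.trans ?_))⟩
    · exact Set.mul_subset_mul_left Set.subset_union_left
    · exact Set.mul_subset_mul_left Set.subset_union_right

/-- The cut sets containing `x` shrink to the coset `A_H x`: each point of the compact set `C \ A_H
N` lies outside this coset, hence is separated from `x` by a pairing with some `a ∈ A`, and finitely
many such conditions suffice. -/
theorem IsModel.exists_isCut [Nontrivial R] (hm : IsModel β ψ χ) {C N : Set (Heisenberg β)}
    (hC : IsCompact C) (hN : IsOpen N) {x : Heisenberg β} (hx : x ∈ N) :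
    ∃ S, IsCut χ S ∧ x ∈ S ∧ ∀ y ∈ S, y ∈ (heisSub β A : Set _) * C →
      y ∈ (heisSub β A : Set _) * N := by
  have hK : IsCompact (C \ ((heisSub β A : Set _) * N)) := hC.diff hN.mul_left
  have h : ∃ S, IsCut χ S ∧ x ∈ S ∧ ∀ y ∈ S, y ∉ C \ ((heisSub β A : Set _) * N) := by
    refine hK.induction_on (p := fun s => ∃ S, IsCut χ S ∧ x ∈ S ∧ ∀ y ∈ S, y ∉ s)
      ⟨_, IsCut.univ χ, trivial, by simp⟩ ?_ ?_ ?_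
    · rintro s t hst ⟨S, hS, hxS, h⟩
      exact ⟨S, hS, hxS, fun y hy hys => h y hy (hst hys)⟩
    · rintro s t ⟨S, hS, hxS, h⟩ ⟨S', hS', hxS', h'⟩
      exact ⟨S ∩ S', hS.inter hS', ⟨hxS, hxS'⟩, fun y hy hys => hys.elim (h y hy.1) (h' y hy.2)⟩
    · rintro z ⟨-, hz⟩
      have hzA : z.w - x.w ∉ A := fun h0 => hz ⟨z * x⁻¹, by
        change (z * x⁻¹).w ∈ A
        rwa [Heisenberg.mul_w, Heisenberg.inv_w, ← sub_eq_add_neg], x, hx, by simp⟩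
      obtain ⟨a, ha, hu⟩ := hm.separates _ hzA
      have hne : ψ (β (z.w - x.w) a) ≠ 1 := fun h0 => by
        rw [h0, sub_self] at hu
        exact not_isUnit_zero hu
      refine ⟨{y | ψ (β (y.w - x.w) a) = ψ (β (z.w - x.w) a)}, mem_nhdsWithin_of_mem_nhds
        (((isLocallyConstant_pairing hm.smooth x.w a).isOpen_fiber _).mem_nhds rfl), _,
        hm.isCut_pairing x.w ha, ?_, ?_⟩
      · simp
      · intro y hy hy'
        exact hne (hy'.symm.trans hy)
  obtain ⟨S, hS, hxS, h⟩ := h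
  refine ⟨S, hS, hxS, ?_⟩
  rintro _ hy ⟨s, hs, c, hc, rfl⟩
  have h1 := h c ((hS.invariant s hs c).1 hy)
  simp only [Set.mem_sdiff, not_and, not_not] at h1
  obtain ⟨s', hs', n, hn, h2⟩ := h1 hc
  exact ⟨s * s', (heisSub β A).mul_mem hs hs', n, hn, by
    change s * s' * n = s * c
    rw [mul_assoc, ← h2]⟩

/-- A stable submodule of `V_A` which contains a function with an invertible value is `V_A`. -/
theorem IsModel.eq_top_of_isUnit (hm : IsModel β ψ χ) {N : Submodule R (Model χ)}
    (hN : ∀ h, ∀ f ∈ N, modelRep χ h f ∈ N) {f₀ : Model χ} (hf₀ : f₀ ∈ N) {x₀ : Heisenberg β}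
    (hu : IsUnit (f₀.1 x₀)) : N = ⊤ := by
  nontriviality (Model χ)
  have : Nontrivial R := Module.nontrivial R (Model χ)
  refine (Submodule.eq_top_iff'.2 fun g => ?_)
  obtain ⟨C, hC, hgC⟩ := g.2.2.2
  have h : ∃ S, IsCut χ S ∧ C ⊆ S ∧ ∃ g' ∈ N, g'.1 = S.indicator g.1 := by
    refine hC.induction_on (p := fun s => ∃ S, IsCut χ S ∧ s ⊆ S ∧ ∃ g' ∈ N, g'.1 =
      S.indicator g.1) ⟨∅, IsCut.empty χ, subset_rfl, 0, N.zero_mem, by simp; rfl⟩ ?_ ?_ ?_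
    · rintro s t hst ⟨S, hS, htS, h⟩
      exact ⟨S, hS, hst.trans htS, h⟩
    · rintro s t ⟨S, hS, hsS, g₁, hg₁, h₁⟩ ⟨S', hS', htS', g₂, hg₂, h₂⟩
      -- Inclusion–exclusion: `1_{S ∪ S'} g = 1_S g + 1_{S'} g - 1_S 1_{S'} g`. Cuts act on pairs,
      -- so a single function is used as a diagonal pair in `N × N`.
      obtain ⟨q, hq, hq1, -⟩ := hS.restrict (N.prod N)
        (fun h p hp => ⟨hN h _ hp.1, hN h _ hp.2⟩) (g₂, g₂) ⟨hg₂, hg₂⟩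
      refine ⟨S ∪ S', hS.union hS', Set.union_subset_union hsS htS', g₁ + g₂ - q.1,
        N.sub_mem (N.add_mem hg₁ hg₂) hq.1, ?_⟩
      change g₁.1 + g₂.1 - q.1.1 = _
      rw [hq1, h₁, h₂, Set.indicator_indicator, ← Set.indicator_union_add_inter,
        add_sub_cancel_right]
    · intro x hx
      -- The translate of `f₀` whose value at `x` is the unit `f₀ x₀`. On a cut set where `f` and
      -- `g` are constant up to the action of `A_H`, `g` is a scalar multiple of `f`.
      let f := modelRep χ (x⁻¹ * x₀) f₀
      have hf : f ∈ N := hN _ _ hf₀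
      have hfx : f.1 x = f₀.1 x₀ := congrArg f₀.1 (mul_inv_cancel_left _ _)
      obtain ⟨D, hD, hfD⟩ := f.2.2.2
      obtain ⟨S, hS, hxS, h⟩ := hm.exists_isCut (hC.union hD)
        ((f.2.2.1.isOpen_fiber (f.1 x)).inter (g.2.2.1.isOpen_fiber (g.1 x))) (x := x) ⟨rfl, rfl⟩
      obtain ⟨q, hq, hq1, -⟩ := hS.restrict (N.prod N)
        (fun h p hp => ⟨hN h _ hp.1, hN h _ hp.2⟩) (f, f) ⟨hf, hf⟩
      refine ⟨S, mem_nhdsWithin_of_mem_nhds (hS.isClopen.isOpen.mem_nhds hxS), S, hS, subset_rfl,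
        (g.1 x * Ring.inverse (f.1 x)) • q.1, N.smul_mem _ hq.1, ?_⟩
      ext y
      change _ * q.1.1 y = _
      rw [hq1]
      by_cases hy : y ∈ S
      · rw [Set.indicator_of_mem hy, Set.indicator_of_mem hy]
        by_cases hyC : y ∈ (heisSub β A : Set _) * (C ∪ D)
        · obtain ⟨s, hs, n, ⟨hn1, hn2⟩, rfl⟩ := h y hy hyC
          have h1 := cInd_apply_mul f ⟨s, hs⟩ n
          have h2 := cInd_apply_mul g ⟨s, hs⟩ n
          change f.1 (s * n) = _ at h1
          change g.1 (s * n) = _ at h2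
          change f.1 n = _ at hn1
          change g.1 n = _ at hn2
          change _ * f.1 (s * n) = g.1 (s * n)
          rw [h1, h2, hn1, hn2]
          linear_combination (g.1 x * χ ⟨s, hs⟩) * Ring.inverse_mul_cancel _ (hfx ▸ hu)
        · have h1 : f.1 y = 0 := by
            by_contra h0
            exact hyC (Set.mul_subset_mul_left Set.subset_union_right (hfD h0))
          have h2 : g.1 y = 0 := by
            by_contra h0
            exact hyC (Set.mul_subset_mul_left Set.subset_union_left (hgC h0))
          change _ * f.1 y = _
          rw [h1, h2, mul_zero]
      · rw [Set.indicator_of_notMem hy, Set.indicator_of_notMem hy, mul_zero]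
  obtain ⟨S, hS, hCS, g', hg', h⟩ := h
  convert hg'
  refine Subtype.ext (h.trans (Set.indicator_eq_self.2 fun y hy => ?_)).symm
  obtain ⟨s, hs, c, hc, rfl⟩ := hgC hy
  exact (hS.invariant s hs c).2 (hCS hc)

/-- If `f` vanishes at `1`, so does its image under an endomorphism of `V_A`. -/
theorem IsModel.apply_one_eq_zero (hm : IsModel β ψ χ) {T : Model χ →ₗ[R] Model χ}
    (hT : ∀ h f, T (modelRep χ h f) = modelRep χ h (T f)) {f : Model χ} (hf : f.1 1 = 0) :
    (T f).1 1 = 0 := by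
  nontriviality R
  obtain ⟨C, hC, hfC⟩ := f.2.2.2
  obtain ⟨S, hS, h1S, h⟩ := hm.exists_isCut hC (f.2.2.1.isOpen_fiber 0) (x := 1) hf
  -- The graph of `T` is stable, so it contains `(1_S f, 1_S T f)`. The first component vanishes by
  -- the choice of `S`, hence so does the second, while `1 ∈ S`.
  obtain ⟨q, hq, h1, h2⟩ := hS.restrict T.graph (fun h p hp => by
    rw [LinearMap.mem_graph_iff] at hp ⊢
    rw [hT, hp]) (f, T f) rfl
  have hq0 : q.1 = 0 := by
    refine Subtype.ext (h1.trans ?_)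
    ext y
    by_cases hy : y ∈ S
    · rw [Set.indicator_of_mem hy]
      by_contra h0
      obtain ⟨s, hs, n, hn, rfl⟩ := h y hy (hfC h0)
      refine h0 ((cInd_apply_mul f ⟨s, hs⟩ n).trans ?_)
      rw [show f.1 n = 0 from hn, mul_zero]
      rfl
    · rw [Set.indicator_of_notMem hy]
      rfl
  rw [LinearMap.mem_graph_iff, hq0, map_zero] at hq
  have := congrFun h2 1
  rw [hq, Set.indicator_of_mem h1S] at this
  exact this.symm

/-- Schur's lemma. -/
theorem IsModel.exists_eq_smul (hm : IsModel β ψ χ) {T : Model χ →ₗ[R] Model χ}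
    (hT : ∀ h f, T (modelRep χ h f) = modelRep χ h (T f)) {e : Model χ} (he : e.1 1 = 1) :
    ∃ c : R, ∀ f, T f = c • f := by
  refine ⟨(T e).1 1, fun f => ?_⟩
  have key (f : Model χ) : (T f).1 1 = (T e).1 1 * f.1 1 := by
    -- Subtracting the multiple of `e` with the same value at `1` determines `(T f) 1`; translating
    -- `f` then gives the other values.
    have h0 : (f - f.1 1 • e).1 1 = 0 := by
      change f.1 1 - f.1 1 * e.1 1 = 0
      rw [he, mul_one, sub_self]
    have h1 := hm.apply_one_eq_zero hT h0
    rw [map_sub, map_smul] at h1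
    change (T f).1 1 - f.1 1 * (T e).1 1 = 0 at h1
    linear_combination h1
  ext x
  have h1 := key (modelRep χ x f)
  rw [hT] at h1
  change (T f).1 (1 * x) = _ * f.1 (1 * x) at h1
  rwa [one_mul] at h1

end Cut

/-! ### Extension of scalars and comparison with an open model. -/

section Comparison

variable {F W : Type*} [Field F] [AddCommGroup W] [Module F W]
  {β : LinearMap.BilinForm F W} {R : Type*} [CommRing R] {ψ : AddChar F R}
  [TopologicalSpace F] [TopologicalSpace W]

theorem isOpen_heisSub {L : AddSubgroup W} (hL : IsOpen (L : Set W)) :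
    IsOpen (heisSub β L : Set (Heisenberg β)) :=
  hL.preimage Heisenberg.continuous_w

variable {L A : AddSubgroup W} {χL : heisSub β L →* Rˣ} {χ : heisSub β A →* Rˣ}

section BaseChange

variable (B : Type*) [CommRing B] [Algebra R B]

/-- `IsModel` is phrased with units because a ring morphism preserves these, whereas it may send a
value `ψ x ≠ 1` to `1`. -/
theorem IsModel.baseChange (hA : IsModel β ψ χ) :
    IsModel β ((algebraMap R B : R →* B).compAddChar ψ) (charExt B χ) where
  two_ne := hA.two_ne
  alt := hA.alt
  smooth := hA.smooth.comp (algebraMap R B)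
  unit x := (hA.unit x).imp (fun h => by simp [h]) fun h => by
    simpa using h.map (algebraMap R B)
  isotropic a ha b hb := by simp [hA.isotropic a ha b hb]
  separates w hw := by
    obtain ⟨a, ha, h⟩ := hA.separates w hw
    exact ⟨a, ha, by simpa using h.map (algebraMap R B)⟩
  ext := ⟨hA.ext.1.comp (Units.map (algebraMap R B : R →* B)), fun t =>
    congrArg (algebraMap R B) (hA.ext.2 t)⟩

/-- The map `f ↦ φ ∘ f` from `V_A` to its scalar extension. -/
def extend (χ : heisSub β A →* Rˣ) : Model χ →+ Model (charExt B χ) :=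
  (scalarExt (heisSub β A) χ B).toAddMonoidHom.comp
    (TensorProduct.mk R B (Model χ) 1).toAddMonoidHom

theorem extend_apply (f : Model χ) (x : Heisenberg β) :
    (extend B χ f).1 x = algebraMap R B (f.1 x) := by
  have : (extend B χ f) = scalarExt (heisSub β A) χ B (1 ⊗ₜ f) := rfl
  rw [this, scalarExt, LinearMap.liftBaseChange_tmul, one_smul]
  rfl

theorem scalarExt_tmul (b : B) (f : Model χ) :
    scalarExt (heisSub β A) χ B (b ⊗ₜ f) = b • extend B χ f := by
  have : (extend B χ f) = scalarExt (heisSub β A) χ B (1 ⊗ₜ f) := rfl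
  rw [this, scalarExt, LinearMap.liftBaseChange_tmul, LinearMap.liftBaseChange_tmul, one_smul]

theorem extend_smul (r : R) (f : Model χ) :
    extend B χ (r • f) = algebraMap R B r • extend B χ f := by
  ext x
  change _ = algebraMap R B r * (extend B χ f).1 x
  rw [extend_apply, extend_apply, ← map_mul]
  rfl

end BaseChange

variable [IsTopologicalRing F] [FiniteDimensional F W] [IsModuleTopology F W]

/-- The kernel and the range are both stable. Cutting an element `f` of the kernel down to `L_H`
gives an element sent to `f 1 • v`, so `f 1 = 0`, and by translation `f = 0`. The range contains
`v`, which takes the value `1`, so it is everything. -/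
theorem IsModel.frob_bijective (hL : IsModel β ψ χL) (hLo : IsOpen (L : Set W))
    (hA : IsModel β ψ χ) {v : Model χ} (hv : ∀ s : heisSub β L, modelRep χ s v = (χL s : R) • v)
    {x₀ : Heisenberg β} (hx₀ : v.1 x₀ = 1) :
    Function.Bijective (frob (modelRep χ) hv (isOpen_heisSub hLo)) := by
  set Φ := frob (modelRep χ) hv (isOpen_heisSub hLo) with hΦ
  have hΦe (h f) : Φ (modelRep χL h f) = modelRep χ h (Φ f) := frob_cIndRep _ hv _ h f
  constructor
  · rw [injective_iff_map_eq_zero]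
    have key (f : Model χL) (hf : Φ f = 0) : f.1 1 = 0 := by
      nontriviality R
      obtain ⟨C, hC, hfC⟩ := f.2.2.2
      -- Here `L_H` is itself an open neighbourhood of `1`, so the cut brings the support of `f`
      -- into `L_H L_H = L_H`.
      obtain ⟨S, hS, h1S, h⟩ := hL.exists_isCut hC (isOpen_heisSub hLo)
        (heisSub β L).one_mem
      obtain ⟨q, ⟨hq, -⟩, h1, -⟩ := hS.restrict (Φ.ker.prod Φ.ker)
        (fun h p hp => by
          have hp1 : Φ p.1 = 0 := hp.1
          have hp2 : Φ p.2 = 0 := hp.2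
          constructor
          · change Φ _ = 0
            rw [hΦe, hp1, map_zero]
          · change Φ _ = 0
            rw [hΦe, hp2, map_zero]) (f, f) ⟨hf, hf⟩
      have hsupp : Function.support q.1.1 ⊆ heisSub β L := by
        rw [h1]
        intro y hy
        have hyS := Set.mem_of_indicator_ne_zero hy
        rw [Function.mem_support, Set.indicator_of_mem hyS] at hy
        obtain ⟨a, ha, b, hb, rfl⟩ := h y hyS (hfC hy)
        exact (heisSub β L).mul_mem ha hb
      have h0 : Φ q.1 = q.1.1 1 • v :=
        frob_of_support_subset (modelRep χ) hv (isOpen_heisSub hLo) q.1 hsupp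
      rw [show Φ q.1 = 0 from hq, h1, Set.indicator_of_mem h1S] at h0
      have h2 := congrArg (fun u : Model χ => u.1 x₀) h0
      change 0 = f.1 1 * v.1 x₀ at h2
      rw [hx₀, mul_one] at h2
      exact h2.symm
    intro f hf
    ext x
    have h1 := key (modelRep χL x f) (by rw [hΦe, hf, map_zero])
    change f.1 (1 * x) = 0 at h1
    rwa [one_mul] at h1
  · rw [← LinearMap.range_eq_top]
    -- The function `δ` equal to `χL` on `L_H` and to `0` elsewhere; its image is `v`.
    obtain ⟨δ, hδ1, -, hδ⟩ := exists_eigenvector (isOpen_heisSub hLo) χL χL hL.ext.1 1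
      (C := {1}) isCompact_singleton (fun s hs => ⟨s, hs, 1, rfl, by rw [one_mul, mul_one]⟩)
      (fun a s h => by
        rw [mul_one, one_mul] at h
        rw [Subtype.ext h])
    refine hA.eq_top_of_isUnit (f₀ := v) ?_ ⟨δ, ?_⟩ (x₀ := x₀) (hx₀ ▸ isUnit_one)
    · rintro h _ ⟨f, rfl⟩
      exact ⟨modelRep χL h f, hΦe h f⟩
    · rw [hΦ, frob_of_support_subset, hδ1, one_smul]
      intro x hx
      obtain ⟨a, s, rfl⟩ := hδ x hx
      rw [mul_one]
      exact (heisSub β L).mul_mem a.2 s.2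

/-- The isomorphism `V_L → V_A` attached to an eigenvector of `L_H` in `V_A`. -/
def IsModel.equivOfEigenvector (hL : IsModel β ψ χL) (hLo : IsOpen (L : Set W))
    (hA : IsModel β ψ χ) {v : Model χ} (hv : ∀ s : heisSub β L, modelRep χ s v = (χL s : R) • v)
    {x₀ : Heisenberg β} (hx₀ : v.1 x₀ = 1) : (modelRep χL).Equiv (modelRep χ) :=
  .mk (LinearEquiv.ofBijective _ (hL.frob_bijective hLo hA hv hx₀))
    fun h => LinearMap.ext fun f => frob_cIndRep _ hv (isOpen_heisSub hLo) h f

variable (B : Type*) [CommRing B] [Algebra R B]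

theorem extend_modelRep (h : Heisenberg β) (f : Model χ) :
    extend B χ (modelRep χ h f) = modelRep (charExt B χ) h (extend B χ f) := by
  ext x
  change _ = (extend B χ f).1 (x * h)
  rw [extend_apply, extend_apply]
  rfl

/-- The eigenvector `v` and its extension to `B` define the two isomorphisms by the same finite sum,
so they are compatible term by term. -/
theorem IsModel.exists_equiv_of_isOpen (hL : IsModel β ψ χL) (hLo : IsOpen (L : Set W))
    (hA : IsModel β ψ χ) {v : Model χ} (hv : ∀ s : heisSub β L, modelRep χ s v = (χL s : R) • v)
    {x₀ : Heisenberg β} (hx₀ : v.1 x₀ = 1) :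
    ∃ (Φ : (modelRep χL).Equiv (modelRep χ))
      (ΦB : (modelRep (charExt B χL)).Equiv (modelRep (charExt B χ))),
      ∀ f, ΦB (extend B χL f) = extend B χ (Φ f) := by
  have hvB : ∀ s : heisSub β L, modelRep (charExt B χ) s (extend B χ v) =
      (charExt B χL s : B) • extend B χ v := fun s => by
    rw [← extend_modelRep, hv, extend_smul]
    rfl
  refine ⟨hL.equivOfEigenvector hLo hA hv hx₀, (hL.baseChange B).equivOfEigenvector hLo
    (hA.baseChange B) hvB (x₀ := x₀) (by rw [extend_apply, hx₀, map_one]), fun f => ?_⟩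
  change frob _ hvB (isOpen_heisSub hLo) (extend B χL f) =
    extend B χ (frob _ hv (isOpen_heisSub hLo) f)
  rw [frob_apply, frob_apply, map_finsum _ (finite_support_frobTerm _ hv (isOpen_heisSub hLo) f)]
  refine finsum_congr fun q => ?_
  induction q using QuotientGroup.induction_on with
  | H x => rw [frobTerm_mk, frobTerm_mk, extend_smul, extend_modelRep, extend_apply]

/-- The scalar extension of `V_A` is generated by the functions with values in the base ring. -/
theorem IsModel.scalarExt_surjective (hA : IsModel β ψ χ) {e : Model χ} (he : e.1 1 = 1) :
    Function.Surjective (scalarExt (heisSub β A) χ B) := by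
  rw [← LinearMap.range_eq_top]
  refine (hA.baseChange B).eq_top_of_isUnit (f₀ := extend B χ e) ?_ ⟨1 ⊗ₜ e, rfl⟩ (x₀ := 1)
    (by rw [extend_apply, he, map_one]; exact isUnit_one)
  rintro h _ ⟨z, rfl⟩
  refine ⟨(modelRep χ h).baseChange B z, ?_⟩
  induction z with
  | zero => simp
  | add x y hx hy => simp only [map_add, hx, hy]
  | tmul b f =>
    rw [LinearMap.baseChange_tmul, scalarExt_tmul, scalarExt_tmul, map_smul, extend_modelRep]

end Comparison

/-! ### Duality for the pairing `ψ ∘ β`. -/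

section Duality

/-- Let `b` be a pairing of `D` and `C` with values in a domain, such that the quotient of `D` by
the kernel of `b` is finite. Every character of this quotient is given by an element of `C`. -/
theorem exists_dual {C D R : Type*} [Monoid C] [Group D] [CommRing R] [IsDomain R]
    (b : D →* (C →* R)) (c : D →* R) (hc : ∀ d, b d = 1 → c d = 1) [Finite (D ⧸ b.ker)] :
    ∃ x, ∀ d, c d * b d x = 1 := by
  classical
  have := Fintype.ofFinite (D ⧸ b.ker)
  let b' : D ⧸ b.ker →* (C →* R) := QuotientGroup.lift b.ker b le_rfl
  let c' : D ⧸ b.ker →* R := QuotientGroup.lift b.ker c fun d hd => hc d hd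
  have hinj : Function.Injective b' := by
    intro q q' h
    induction q using QuotientGroup.induction_on with | H d =>
    induction q' using QuotientGroup.induction_on with | H d' =>
    change b d = b d' at h
    rw [QuotientGroup.eq, MonoidHom.mem_ker, map_mul, ← h, ← map_mul, inv_mul_cancel, map_one]
  have hli := (linearIndependent_monoidHom C R).comp b' hinj
  -- Linear independence of characters gives an `x` at which `∑ c' q * b' q x` is nonzero. This is a
  -- sum of values of the character `η` of a finite group, and such a sum vanishes unless `η = 1`.
  have hne : ∑ q, c' q • (b' q : C → R) ≠ 0 := by
    intro h0
    have := Fintype.linearIndependent_iff.1 hli c' h0 1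
    rw [map_one] at this
    exact one_ne_zero this
  obtain ⟨x, hx⟩ := Function.ne_iff.1 hne
  let η : D ⧸ b.ker →* R := c' * (MonoidHom.eval x).comp b'
  have hη : η = 1 := by
    by_contra h
    refine hx ?_
    rw [Finset.sum_apply]
    exact sum_hom_units_eq_zero η h
  exact ⟨x, fun d => DFunLike.congr_fun hη (d : D ⧸ b.ker)⟩

variable {F W : Type*} [Field F] [AddCommGroup W] [Module F W]
  {β : LinearMap.BilinForm F W} {R : Type*} [CommRing R] {ψ : AddChar F R}

theorem pairing_eq_one_comm (hβ : β.IsAlt) {x y : W} :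
    ψ (β x y) = 1 ↔ ψ (β y x) = 1 := by
  rw [← hβ.neg_eq x y]
  have h := AddChar.map_add_eq_mul ψ (β x y) (-β x y)
  rw [add_neg_cancel, AddChar.map_zero_eq_one] at h
  constructor
  · intro h1
    rw [h1, one_mul] at h
    exact h.symm
  · intro h1
    rw [h1, mul_one] at h
    exact h.symm

/-- The character `y ↦ ψ (β y w)` on a subgroup. -/
def pairChar (β : LinearMap.BilinForm F W) (ψ : AddChar F R) (C : AddSubgroup W) (w : W) :
    Multiplicative C →* R where
  toFun y := ψ (β (y.toAdd : W) w)
  map_one' := by simp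
  map_mul' x y := by simp [AddChar.map_add_eq_mul]

theorem pairChar_zero (C : AddSubgroup W) : pairChar β ψ C 0 = 1 := by
  ext y
  simp [pairChar]

theorem pairChar_add (C : AddSubgroup W) (w w' : W) :
    pairChar β ψ C (w + w') = pairChar β ψ C w * pairChar β ψ C w' := by
  ext y
  simp [pairChar, AddChar.map_add_eq_mul]

theorem pairChar_eq_one_iff {C : AddSubgroup W} {w : W} :
    pairChar β ψ C w = 1 ↔ ∀ y ∈ C, ψ (β y w) = 1 :=
  ⟨fun h y hy => DFunLike.congr_fun h (Multiplicative.ofAdd (⟨y, hy⟩ : C)),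
    fun h => MonoidHom.ext fun y => h _ y.toAdd.2⟩

theorem exists_ne_one_of_ne_zero (hβ : β.Nondegenerate) (hψ : ψ ≠ 1) {w : W} (hw : w ≠ 0) :
    ∃ y, ψ (β y w) ≠ 1 := by
  obtain ⟨t, ht⟩ := AddChar.ne_one_iff.1 hψ
  obtain ⟨y, hy⟩ : ∃ y, β y w ≠ 0 := by
    by_contra! h
    exact hw (hβ.2 w h)
  refine ⟨(t / β y w) • y, ?_⟩
  rwa [map_smul, LinearMap.smul_apply, smul_eq_mul, div_mul_cancel₀ _ hy]

theorem forall_mem_closure_eq_one {s : Set W} {w : W} (h : ∀ y ∈ s, ψ (β y w) = 1) :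
    ∀ y ∈ AddSubgroup.closure s, ψ (β y w) = 1 := by
  intro y hy
  induction hy using AddSubgroup.closure_induction with
  | mem x hx => exact h x hx
  | zero => simp
  | add x y _ _ hx hy => rw [map_add, LinearMap.add_apply, AddChar.map_add_eq_mul, hx, hy, one_mul]
  | neg x _ hx =>
    have h := AddChar.map_add_eq_mul ψ (β x w) (-β x w)
    rw [add_neg_cancel, AddChar.map_zero_eq_one, hx, one_mul] at h
    rw [map_neg, LinearMap.neg_apply, ← h]

variable [TopologicalSpace F] [IsTopologicalRing F] [TopologicalSpace W] [IsModuleTopology F W]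

theorem isLocallyConstant_pairing_left (hψ : IsLocallyConstant ψ) (y : W) :
    IsLocallyConstant (fun w => ψ (β y w)) :=
  hψ.comp_continuous (IsModuleTopology.continuous_of_linearMap (β y))

theorem isLocallyConstant_pairing_right (hψ : IsLocallyConstant ψ) (y : W) :
    IsLocallyConstant (fun w => ψ (β w y)) :=
  hψ.comp_continuous (IsModuleTopology.continuous_of_linearMap (β.flip y))

theorem exists_finite_separating {Y K : Set W} (hψ : IsLocallyConstant ψ) (hK : IsCompact K)
    (h : ∀ w ∈ K, ∃ y ∈ Y, ψ (β w y) ≠ 1) :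
    ∃ T ⊆ Y, T.Finite ∧ ∀ w ∈ K, ∃ y ∈ T, ψ (β w y) ≠ 1 := by
  refine hK.induction_on (p := fun K => ∃ T ⊆ Y, T.Finite ∧ ∀ w ∈ K, ∃ y ∈ T, ψ (β w y) ≠ 1)
    ⟨∅, Set.empty_subset _, Set.finite_empty, by simp⟩ ?_ ?_ ?_
  · rintro s t hst ⟨T, hTY, hT, h⟩
    exact ⟨T, hTY, hT, fun w hw => h w (hst hw)⟩
  · rintro s t ⟨T, hTY, hT, h⟩ ⟨T', hTY', hT', h'⟩
    refine ⟨T ∪ T', Set.union_subset hTY hTY', hT.union hT', ?_⟩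
    rintro w (hw | hw)
    · obtain ⟨y, hy, hwy⟩ := h w hw
      exact ⟨y, Or.inl hy, hwy⟩
    · obtain ⟨y, hy, hwy⟩ := h' w hw
      exact ⟨y, Or.inr hy, hwy⟩
  · intro w hw
    obtain ⟨y, hy, hwy⟩ := h w hw
    refine ⟨{x | ψ (β x y) = ψ (β w y)}, mem_nhdsWithin_of_mem_nhds
      (((isLocallyConstant_pairing_right hψ y).isOpen_fiber _).mem_nhds rfl), {y},
      Set.singleton_subset_iff.2 hy, Set.finite_singleton y, fun x hx => ⟨y, rfl, ?_⟩⟩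
    rwa [show ψ (β x y) = ψ (β w y) from hx]

/-- Two smooth extensions of `ψ` to `A_H` and to `L_H`, where `L` is compact, differ on
`A_H ∩ L_H` by the character `ψ (β w₀ ·)` for some `w₀` in `W`. -/
theorem exists_translation [IsDomain R] (hβ : β.IsAlt) (hβ' : β.Nondegenerate)
    (hψ : IsLocallyConstant ψ) (hψ1 : ψ ≠ 1) {A L : AddSubgroup W} (hA : IsClosed (A : Set W))
    (hL : IsCompact (L : Set W)) {χ : heisSub β A →* Rˣ} (hχ : IsSmoothExtension ψ χ)
    {χL : heisSub β L →* Rˣ} (hχL : IsSmoothExtension ψ χL) :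
    ∃ w₀ : W, ∀ (x : Heisenberg β) (hx : x ∈ heisSub β A) (hx' : x ∈ heisSub β L),
      (χL ⟨x, hx'⟩ : R) = χ ⟨x, hx⟩ * ψ (β w₀ x.w) := by
  have := IsModuleTopology.topologicalAddGroup F W
  have hDc : IsCompact ((A ⊓ L : AddSubgroup W) : Set W) := hL.inter_left hA
  obtain ⟨U, hU, hU1⟩ := exists_nhds_eq_one hχ.1
  obtain ⟨V, hV, hV1⟩ := exists_nhds_eq_one hχL.1
  have hcont : Continuous (fun w : W => (⟨w, 0⟩ : Heisenberg β)) :=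
    Heisenberg.continuous_iff.2 ⟨continuous_id, continuous_const⟩
  have hN : (fun w : W => (⟨w, 0⟩ : Heisenberg β)) ⁻¹' (U ∩ V) ∈ 𝓝 (0 : W) :=
    hcont.tendsto 0 (Filter.inter_mem hU hV)
  obtain ⟨N, hNUV, hNo, hN0⟩ := mem_nhds_iff.1 hN
  -- Both characters are trivial on the elements `(w, 0)` with `w ∈ N`. A finite `T` detects the
  -- elements of `A ∩ L` outside `N`, so any element orthogonal to `T` has its `W`-component in `N`.
  obtain ⟨T, -, hT, hsep⟩ := exists_finite_separating (β := β) (Y := Set.univ) hψ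
    (hDc.diff hNo) fun w hw => by
      obtain ⟨y, hy⟩ := exists_ne_one_of_ne_zero hβ' hψ1 (w := w) fun h0 => hw.2 (h0 ▸ hN0)
      exact ⟨y, trivial, fun h => hy ((pairing_eq_one_comm hβ).1 h)⟩
  let b : heisSub β (A ⊓ L) →* (Multiplicative (AddSubgroup.closure T) →* R) :=
    { toFun := fun x => pairChar β ψ _ x.1.w
      map_one' := pairChar_zero _
      map_mul' := fun x y => pairChar_add _ _ _ }
  let c : heisSub β (A ⊓ L) →* Rˣ :=
    { toFun := fun x => χ ⟨x.1, x.2.1⟩ * (χL ⟨x.1, x.2.2⟩)⁻¹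
      map_one' := by
        rw [mul_inv_eq_one]
        exact (map_one χ).trans (map_one χL).symm
      map_mul' := fun x y => by
        have h1 : χ ⟨x * y, _⟩ = _ := map_mul χ ⟨x.1, x.2.1⟩ ⟨y.1, y.2.1⟩
        have h2 : χL ⟨x * y, _⟩ = _ := map_mul χL ⟨x.1, x.2.2⟩ ⟨y.1, y.2.2⟩
        exact (congrArg₂ (fun u v => u * v⁻¹) h1 h2).trans (by
          rw [mul_inv, mul_mul_mul_comm]) }
  have hker (x : heisSub β (A ⊓ L)) (hx : b x = 1) : c x = 1 := by
    have hxN : x.1.w ∈ N := by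
      by_contra h
      obtain ⟨y, hy, hne⟩ := hsep x.1.w ⟨x.2, h⟩
      exact hne ((pairing_eq_one_comm hβ).1
        (pairChar_eq_one_iff.1 hx y (AddSubgroup.subset_closure hy)))
    obtain ⟨h1, h2⟩ := hNUV hxN
    have h3 := hU1 ⟨⟨x.1.w, 0⟩, x.2.1⟩ h1
    have h4 := hV1 ⟨⟨x.1.w, 0⟩, x.2.2⟩ h2
    have h5 := hχ.apply_mk_zero x.2.1 x.1.t
    have h6 := hχL.apply_mk_zero x.2.2 x.1.t
    rw [h3] at h5
    rw [h4, ← h5] at h6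
    exact mul_inv_eq_one.2 (Units.ext h6.symm)
  -- The quotient is the image of the compact group `A ∩ L` under a locally constant map; the centre
  -- already lies in the kernel.
  have : Finite (heisSub β (A ⊓ L) ⧸ b.ker) := by
    let f : (A ⊓ L : AddSubgroup W) → heisSub β (A ⊓ L) ⧸ b.ker :=
      fun w => ((⟨⟨w, 0⟩, w.2⟩ : heisSub β (A ⊓ L)) : heisSub β (A ⊓ L) ⧸ b.ker)
    have hf : IsLocallyConstant f := by
      rw [IsLocallyConstant.iff_eventually_eq]
      intro w
      have h1 : ∀ᶠ x : W in 𝓝 w, ∀ y ∈ T, ψ (β y x) = ψ (β y w) :=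
        (hT.eventually_all).2 fun y _ =>
          (IsLocallyConstant.iff_eventually_eq _).1 (isLocallyConstant_pairing_left hψ y) w
      filter_upwards [continuous_subtype_val.tendsto w h1] with x hx
      have hx : ∀ y ∈ T, ψ (β y (x : W)) = ψ (β y w) := hx
      refine QuotientGroup.eq.2 ((MonoidHom.mem_ker).2 (pairChar_eq_one_iff.2
        (forall_mem_closure_eq_one fun y hy => ?_)))
      change ψ (β y (-(x : W) + w)) = 1
      rw [map_add, AddChar.map_add_eq_mul, ← hx y hy, ← AddChar.map_add_eq_mul, map_neg,
        neg_add_cancel, AddChar.map_zero_eq_one]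
    have : CompactSpace (A ⊓ L : AddSubgroup W) := isCompact_iff_compactSpace.1 hDc
    have hsurj : Set.range f = Set.univ := by
      refine Set.eq_univ_of_forall fun q => ?_
      induction q using QuotientGroup.induction_on with | H x =>
      refine ⟨⟨x.1.w, x.2⟩, QuotientGroup.eq.2 ((MonoidHom.mem_ker).2 ?_)⟩
      change pairChar β ψ _ (-x.1.w + x.1.w) = 1
      rw [neg_add_cancel, pairChar_zero]
    exact Set.finite_univ_iff.1 (hsurj ▸ hf.range_finite)
  obtain ⟨y, hy⟩ := exists_dual b ((Units.coeHom R).comp c) fun x hx => by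
    rw [MonoidHom.comp_apply, hker x hx, map_one]
  refine ⟨y.toAdd, fun x hx hx' => ?_⟩
  have h := hy ⟨x, hx, hx'⟩
  change ((χ ⟨x, hx⟩ : R) * ((χL ⟨x, hx'⟩)⁻¹ : Rˣ)) * ψ (β (y.toAdd : W) x.w) = 1 at h
  calc (χL ⟨x, hx'⟩ : R) = χL ⟨x, hx'⟩ * ((χ ⟨x, hx⟩ : R) * ((χL ⟨x, hx'⟩)⁻¹ : Rˣ) *
        ψ (β (y.toAdd : W) x.w)) := by rw [h, mul_one]
    _ = _ := by
      linear_combination ((χ ⟨x, hx⟩ : R) * ψ (β (y.toAdd : W) x.w)) * (χL ⟨x, hx'⟩).mul_inv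

/-- If `L` is compact and `A` is self-dual, then the orthogonal of `A ∩ L^⊥` is `L + A`. -/
theorem exists_add_eq_of_orthogonal [IsDomain R] (hψ : IsLocallyConstant ψ) {A L : AddSubgroup W}
    (hA : IsSelfDual β ψ A) (hL : IsCompact (L : Set W))
    (htor : ∀ y : W, ∃ n : ℕ, 0 < n ∧ ∀ l ∈ L, ψ (β l (n • y)) = 1) {w : W}
    (hw : ∀ y ∈ A, (∀ l ∈ L, ψ (β l y) = 1) → ψ (β w y) = 1) :
    ∃ l ∈ L, w - l ∈ A := by
  by_contra! hcon
  have := IsModuleTopology.topologicalAddGroup F W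
  -- If no element of `w + L` lies in `A`, self-duality detects each of them by an element of `A`,
  -- and by compactness a finite `T ⊆ A` suffices. Duality for `⟨T⟩` will give an `l ∈ L` with `w +
  -- l` orthogonal to `T`.
  obtain ⟨T, hTA, hT, hsep⟩ := exists_finite_separating (β := β) (Y := A) (K := (w + ·) '' L) hψ
    (hL.image (continuous_const_add w)) (by
      rintro _ ⟨l, hl, rfl⟩
      have h := hcon (-l) (L.neg_mem hl)
      rw [sub_neg_eq_add, hA.2] at h
      push Not at h
      exact h)
  have hTA' : AddSubgroup.closure T ≤ A := (AddSubgroup.closure_le A).2 hTA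
  let b : Multiplicative (AddSubgroup.closure T) →* (Multiplicative L →* R) :=
    { toFun := fun y => pairChar β ψ L y.toAdd
      map_one' := pairChar_zero L
      map_mul' := fun x y => pairChar_add L _ _ }
  let c : Multiplicative (AddSubgroup.closure T) →* R :=
    { toFun := fun y => ψ (β w y.toAdd)
      map_one' := by simp
      map_mul' := fun x y => by simp [AddChar.map_add_eq_mul] }
  have : Finite T := hT
  have hfg : Group.FG (Multiplicative (AddSubgroup.closure T)) :=
    AddGroup.fg_iff_mul_fg.1 (AddGroup.closure_finite_fg T)
  -- A finitely generated commutative group which is torsion, by `htor`, is finite.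
  have : Finite (Multiplicative (AddSubgroup.closure T) ⧸ b.ker) := by
    refine CommGroup.finite_of_fg_isMulTorsion _ fun q => ?_
    induction q using QuotientGroup.induction_on with | H y =>
    obtain ⟨n, hn, h⟩ := htor y.toAdd
    refine isOfFinOrder_iff_pow_eq_one.2 ⟨n, hn, ?_⟩
    rw [← QuotientGroup.mk_pow, QuotientGroup.eq_one_iff, MonoidHom.mem_ker]
    exact pairChar_eq_one_iff.2 h
  obtain ⟨l, hl⟩ := exists_dual b c fun y hy =>
    hw _ (hTA' y.toAdd.2) (pairChar_eq_one_iff.1 hy)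
  obtain ⟨y, hy, hne⟩ := hsep _ ⟨l.toAdd, l.toAdd.2, rfl⟩
  refine hne ?_
  have h : ψ (β w y) * ψ (β (l.toAdd : W) y) = 1 :=
    hl (Multiplicative.ofAdd ⟨y, AddSubgroup.subset_closure hy⟩)
  rw [← h]
  change ψ (β (w + (l.toAdd : W)) y) = _
  rw [map_add, LinearMap.add_apply, AddChar.map_add_eq_mul]

end Duality

/-! ### Roots of unity of `p`-power order when `p` is invertible. -/

section Units

/-- If `ζ ^ p = 1` and `ζ ≠ 1`, then `1 + ζ + ⋯ + ζ ^ (p - 1) = 0`; modulo `ζ - 1` this sum is `p`,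
so `ζ - 1` divides the unit `p`. Otherwise induct, since `ζ - 1` divides `ζ ^ p - 1`. -/
theorem isUnit_sub_one_of_pow_prime_pow {R : Type*} [CommRing R] [IsDomain R] {p : ℕ}
    (hp : IsUnit (p : R)) (k : ℕ) {ζ : R} (hζ : ζ ^ p ^ k = 1) : ζ = 1 ∨ IsUnit (ζ - 1) := by
  induction k generalizing ζ with
  | zero => left; simpa using hζ
  | succ k ih =>
    rw [pow_succ', pow_mul] at hζ
    by_cases h1 : ζ = 1
    · exact Or.inl h1
    right
    rcases ih hζ with h | h
    · have h0 : ∑ i ∈ Finset.range p, ζ ^ i = 0 := by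
        have := mul_geom_sum ζ p
        rw [h, sub_self] at this
        exact (mul_eq_zero.1 this).resolve_left (sub_ne_zero.2 h1)
      have h2 : ζ - 1 ∣ ∑ i ∈ Finset.range p, (ζ ^ i - 1) :=
        Finset.dvd_sum fun i _ => by simpa using sub_dvd_pow_sub_pow ζ 1 i
      rw [Finset.sum_sub_distrib, h0, zero_sub, Finset.sum_const, Finset.card_range,
        nsmul_one, dvd_neg] at h2
      exact isUnit_of_dvd_unit h2 hp
    · exact isUnit_of_dvd_unit (by simpa using sub_dvd_pow_sub_pow ζ 1 p) h

theorem isUnit_natCast_coeffRing (K : Type*) [Field K] [CharZero K] {p : ℕ} (hp : p ≠ 0) :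
    IsUnit (p : coeffRing K p) := by
  refine IsUnit.of_mul_eq_one ⟨(p : K)⁻¹, Algebra.subset_adjoin rfl⟩ ?_
  refine Subtype.ext ?_
  change ((p : coeffRing K p) : K) * (p : K)⁻¹ = 1
  rw [show ((p : coeffRing K p) : K) = p from map_natCast (coeffRing K p).val p]
  exact mul_inv_cancel₀ (Nat.cast_ne_zero.2 hp)

end Units

/-! ### Topology of the field and smooth additive characters. -/

section FieldTopology

variable {F : Type*} [Field F] [TopologicalSpace F] {p : ℕ}

open ValuativeRel in
-- Fix `c` with `ψ c ≠ 1`. If `x` is large, then `c / x` is small enough to lie in `U`, and `ψ ((c /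
-- x) * x) ≠ 1`. So the orthogonal of `U` is bounded, and closed balls are compact.
theorem IsFiniteOrLocalField.exists_isCompact (hF : IsFiniteOrLocalField F p) {R : Type*}
    [CommRing R] {ψ : AddChar F R} (hψ : ψ ≠ 1) {U : Set F} (hU : U ∈ 𝓝 0) :
    ∃ C : Set F, IsCompact C ∧ ∀ x, (∀ u ∈ U, ψ (u * x) = 1) → x ∈ C := by
  obtain ⟨_, _, _⟩ | ⟨_, _, _⟩ := hF
  · exact ⟨Set.univ, Set.finite_univ.isCompact, fun _ _ => trivial⟩
  · obtain ⟨γ, hγ⟩ := (IsValuativeTopology.mem_nhds_zero_iff U).1 hU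
    obtain ⟨c, hc⟩ := AddChar.ne_one_iff.1 hψ
    refine ⟨_, IsNonarchimedeanLocalField.isCompact_closedBall F (valuation F c / γ),
      fun x hx => ?_⟩
    change valuation F x ≤ _
    by_contra! hlt
    have hx0 : x ≠ 0 := by
      rintro rfl
      rw [map_zero] at hlt
      exact not_lt_zero hlt
    refine hc ?_
    rw [← div_mul_cancel₀ c hx0]
    refine hx _ (hγ ?_)
    change valuation F (c / x) < γ
    have hv : 0 < valuation F x := zero_lt_iff.2 ((Valuation.ne_zero_iff _).2 hx0)
    rw [div_lt_iff₀ (zero_lt_iff.2 γ.ne_zero)] at hlt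
    rwa [map_div₀, div_lt_iff₀ hv, mul_comm]

open ValuativeRel in
theorem IsFiniteOrLocalField.tendsto_pow (hF : IsFiniteOrLocalField F p) :
    Filter.Tendsto (fun k : ℕ => (p : F) ^ k) Filter.atTop (𝓝 0) := by
  obtain ⟨_, _, _⟩ | ⟨_, _, _⟩ := hF
  · refine tendsto_const_nhds.congr' ?_
    filter_upwards [Filter.eventually_ne_atTop 0] with k hk
    rw [CharP.cast_eq_zero, zero_pow hk]
  -- The residual characteristic is `p`, so `p` lies in the maximal ideal; the valuation has rank at
  -- most one, so powers of `p` become arbitrarily small.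
  · have hp : valuation F (p : F) < 1 := by
      let q : (valuation F).integer := p
      have h0 : IsLocalRing.residue (valuation F).integer q = 0 := by
        rw [map_natCast, CharP.cast_eq_zero]
      rw [IsLocalRing.residue_eq_zero_iff, IsLocalRing.mem_maximalIdeal, mem_nonunits_iff,
        (Valuation.integer.integers (valuation F)).isUnit_iff_valuation_eq_one] at h0
      exact lt_of_le_of_ne q.2 h0
    rw [(IsValuativeTopology.hasBasis_nhds_zero F).tendsto_right_iff]
    rintro γ -
    have := ValuativeRel.isRankLeOne_iff_mulArchimedean.1 (inferInstance : IsRankLeOne F)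
    obtain ⟨n, hn⟩ : ∃ n : ℕ, valuation F (p : F) ^ n < γ := by
      by_cases h0 : valuation F (p : F) = 0
      · exact ⟨1, by rw [h0, pow_one]; exact zero_lt_iff.2 γ.ne_zero⟩
      · obtain ⟨n, hn⟩ := MulArchimedean.arch (γ⁻¹ : (ValueGroupWithZero F)ˣ).val
          ((one_lt_inv₀ (zero_lt_iff.2 h0)).2 hp)
        refine ⟨n + 1,
          (pow_lt_pow_right_of_lt_one₀ (zero_lt_iff.2 h0) hp n.lt_succ_self).trans_le ?_⟩
        rw [inv_pow, Units.val_inv_eq_inv_val] at hn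
        exact (inv_le_inv₀ (zero_lt_iff.2 γ.ne_zero) (zero_lt_iff.2 (pow_ne_zero n h0))).1 hn
    filter_upwards [Filter.eventually_ge_atTop n] with k hk
    rw [map_pow]
    exact (pow_le_pow_of_le_one zero_le hp.le hk).trans_lt hn

variable [IsTopologicalRing F]

open ValuativeRel in
theorem IsFiniteOrLocalField.exists_addSubgroup (hF : IsFiniteOrLocalField F p) {U : Set F}
    (hU : U ∈ 𝓝 0) :
    ∃ V : AddSubgroup F, IsOpen (V : Set F) ∧ IsCompact (V : Set F) ∧ (V : Set F) ⊆ U := by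
  obtain ⟨_, _, _⟩ | ⟨_, _, _⟩ := hF
  · exact ⟨⊥, isOpen_discrete _, by simp, by simpa using mem_of_mem_nhds hU⟩
  · obtain ⟨γ, hγ⟩ := (IsValuativeTopology.mem_nhds_zero_iff U).1 hU
    have ho : IsOpen ((valuation F).ltAddSubgroup γ : Set F) :=
      AddSubgroup.isOpen_of_mem_nhds (g := 0) _
        ((IsValuativeTopology.mem_nhds_zero_iff _).2 ⟨γ, subset_rfl⟩)
    exact ⟨(valuation F).ltAddSubgroup γ, ho,
      (IsNonarchimedeanLocalField.isCompact_closedBall F γ).of_isClosed_subset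
        (AddSubgroup.isClosed_of_isOpen _ ho) fun x hx =>
          (show valuation F x < γ from hx).le, hγ⟩

theorem IsFiniteOrLocalField.eventually_eq_one (hF : IsFiniteOrLocalField F p) {R : Type*}
    [CommRing R] {ψ : AddChar F R} (hψ : IsLocallyConstant ψ) (x : F) :
    ∃ k : ℕ, ψ (p ^ k * x) = 1 := by
  have h := ((hF.tendsto_pow).mul_const x).eventually
    (by rw [zero_mul]; exact (IsLocallyConstant.iff_eventually_eq _).1 hψ 0)
  obtain ⟨k, hk⟩ := h.exists
  exact ⟨k, hk.trans (AddChar.map_zero_eq_one ψ)⟩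

theorem IsFiniteOrLocalField.isUnit_sub_one (hF : IsFiniteOrLocalField F p) {R : Type*}
    [CommRing R] [IsDomain R] (hp : IsUnit (p : R)) {ψ : AddChar F R} (hψ : IsLocallyConstant ψ)
    (x : F) : ψ x = 1 ∨ IsUnit (ψ x - 1) := by
  obtain ⟨k, hk⟩ := hF.eventually_eq_one hψ x
  refine isUnit_sub_one_of_pow_prime_pow hp k ?_
  rw [← AddChar.map_nsmul_eq_pow, nsmul_eq_mul]
  exact_mod_cast hk

end FieldTopology

/-! ### Compact open subgroups and orthogonals in the symplectic space. -/

section SpaceTopology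

variable {F : Type*} [Field F] [TopologicalSpace F] [IsTopologicalRing F] {p : ℕ}
  {W : Type*} [AddCommGroup W] [Module F W] [TopologicalSpace W] [IsModuleTopology F W]
  {β : LinearMap.BilinForm F W} {R : Type*} [CommRing R] {ψ : AddChar F R}

theorem IsFiniteOrLocalField.exists_nsmul_orthogonal [Fact p.Prime] (hF : IsFiniteOrLocalField F p)
    (hψ : IsLocallyConstant ψ) {L : Set W} (hL : IsCompact L) (y : W) :
    ∃ n : ℕ, 0 < n ∧ ∀ l ∈ L, ψ (β l (n • y)) = 1 := by
  refine hL.induction_on (p := fun L => ∃ n : ℕ, 0 < n ∧ ∀ l ∈ L, ψ (β l (n • y)) = 1)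
    ⟨1, one_pos, by simp⟩ ?_ ?_ ?_
  · rintro s t hst ⟨n, hn, h⟩
    exact ⟨n, hn, fun l hl => h l (hst hl)⟩
  · rintro s t ⟨n, hn, h⟩ ⟨m, hm, h'⟩
    refine ⟨n * m, Nat.mul_pos hn hm, ?_⟩
    rintro l (hl | hl)
    · rw [mul_comm, mul_nsmul', map_nsmul, AddChar.map_nsmul_eq_pow, h l hl, one_pow]
    · rw [mul_nsmul', map_nsmul, AddChar.map_nsmul_eq_pow, h' l hl, one_pow]
  · intro l hl
    obtain ⟨k, hk⟩ := hF.eventually_eq_one hψ (β l y)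
    have hk' : ψ (β l (p ^ k • y)) = 1 := by
      rw [map_nsmul, nsmul_eq_mul]
      exact_mod_cast hk
    refine ⟨{x | ψ (β x (p ^ k • y)) = ψ (β l (p ^ k • y))}, mem_nhdsWithin_of_mem_nhds
      (((isLocallyConstant_pairing_right hψ _).isOpen_fiber _).mem_nhds rfl), p ^ k,
      pow_pos (Fact.out (p := p.Prime)).pos k, fun x hx => ?_⟩
    exact Eq.trans hx hk'

variable [FiniteDimensional F W]

theorem IsFiniteOrLocalField.exists_addSubgroup_module (hF : IsFiniteOrLocalField F p) {U : Set W}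
    (hU : U ∈ 𝓝 0) :
    ∃ V : AddSubgroup W, IsOpen (V : Set W) ∧ IsCompact (V : Set W) ∧ (V : Set W) ⊆ U := by
  let e : W ≃ₗ[F] (Fin (Module.finrank F W) → F) := (Module.finBasis F W).equivFun
  have := IsModuleTopology.toContinuousAdd F W
  have he : Continuous e := IsModuleTopology.continuous_of_linearMap e.toLinearMap
  have he' : Continuous e.symm := IsModuleTopology.continuous_of_linearMap e.symm.toLinearMap
  have hU' : e.symm ⁻¹' U ∈ 𝓝 (0 : Fin (Module.finrank F W) → F) :=
    he'.tendsto 0 (by rwa [map_zero])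
  rw [nhds_pi, Filter.mem_pi] at hU'
  obtain ⟨I, -, t, ht, htU⟩ := hU'
  choose V hVo hVc hVt using fun i => hF.exists_addSubgroup (ht i)
  refine ⟨(AddSubgroup.pi Set.univ V).comap e.toLinearMap.toAddMonoidHom, ?_, ?_, ?_⟩
  · exact (isOpen_set_pi Set.finite_univ fun i _ => hVo i).preimage he
  · have h := (isCompact_univ_pi hVc).image he'
    refine (congrArg IsCompact ?_).mp h
    exact e.toEquiv.symm.image_eq_preimage_symm _
  · intro w hw
    have h1 : e w ∈ Set.pi I t := fun i _ => hVt i (hw i trivial)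
    have h2 := htU h1
    rwa [Set.mem_preimage, e.symm_apply_apply] at h2

/-- By nondegeneracy the numbers `β (b i) w`, for a basis `b`, are coordinates of `w`. As `L`
contains `u • b i` for all small `u`, each coordinate is confined to a compact set. -/
theorem IsFiniteOrLocalField.isCompact_orthogonal (hF : IsFiniteOrLocalField F p)
    (hβ : β.Nondegenerate) (hψ : ψ ≠ 1) {L : AddSubgroup W}
    (hL : IsOpen (L : Set W)) : ∃ C : Set W, IsCompact C ∧
      ∀ w, (∀ l ∈ L, ψ (β l w) = 1) → w ∈ C := by
  let b := Module.finBasis F W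
  have := IsModuleTopology.toContinuousAdd F W
  have hU (i) : {u : F | u • b i ∈ L} ∈ 𝓝 (0 : F) := by
    have hc : Continuous (fun u : F => u • b i) := continuous_id.smul continuous_const
    exact hc.tendsto 0 (hL.mem_nhds (by simp))
  choose C hC h using fun i => hF.exists_isCompact hψ (hU i)
  let T : W →ₗ[F] (Fin (Module.finrank F W) → F) := LinearMap.pi fun i => β (b i)
  have hT : Function.Injective T := by
    rw [injective_iff_map_eq_zero]
    intro w hw
    refine hβ.2 w fun y => ?_
    have : β.flip w = 0 := b.ext fun i => congrFun hw i
    exact LinearMap.congr_fun this y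
  let e := LinearEquiv.ofInjectiveOfFinrankEq T hT (by simp)
  refine ⟨e.symm '' Set.pi Set.univ C, (isCompact_univ_pi hC).image
    (IsModuleTopology.continuous_of_linearMap e.symm.toLinearMap), fun w hw =>
    ⟨e w, fun i _ => ?_, e.symm_apply_apply w⟩⟩
  refine h i _ fun u hu => ?_
  have h1 := hw _ hu
  rwa [map_smul, LinearMap.smul_apply, smul_eq_mul] at h1

end SpaceTopology

/-! ### Compact open self-dual subgroups and eigenvectors. -/

section OpenModel

variable {F W : Type*} [Field F] [AddCommGroup W] [Module F W]
  {β : LinearMap.BilinForm F W} {R : Type*} [CommRing R] {ψ : AddChar F R}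

theorem addChar_add_eq_one {x y : F} (hx : ψ x = 1) (hy : ψ y = 1) : ψ (x + y) = 1 := by
  rw [AddChar.map_add_eq_mul, hx, hy, one_mul]

theorem addChar_neg_eq_one {x : F} (hx : ψ x = 1) : ψ (-x) = 1 := by
  have h := AddChar.map_add_eq_mul ψ x (-x)
  rw [add_neg_cancel, AddChar.map_zero_eq_one, hx, one_mul] at h
  exact h.symm

/-- The orthogonal of a subgroup for `ψ ∘ β`. -/
def orthogonal (β : LinearMap.BilinForm F W) (ψ : AddChar F R) (L : AddSubgroup W) :
    AddSubgroup W where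
  carrier := {w | ∀ l ∈ L, ψ (β l w) = 1}
  zero_mem' l _ := by simp
  add_mem' hx hy l hl := by
    rw [map_add]
    exact addChar_add_eq_one (hx l hl) (hy l hl)
  neg_mem' hx l hl := by
    rw [map_neg]
    exact addChar_neg_eq_one (hx l hl)

variable [TopologicalSpace F] [TopologicalSpace W]

theorem IsModel.of_isSelfDual (h2 : (2 : F) ≠ 0) (hβ : β.IsAlt) (hψ : IsLocallyConstant ψ)
    (hu : ∀ x, ψ x = 1 ∨ IsUnit (ψ x - 1)) {A : AddSubgroup W} (hA : IsSelfDual β ψ A)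
    {χ : heisSub β A →* Rˣ} (hχ : IsSmoothExtension ψ χ) : IsModel β ψ χ where
  two_ne := h2
  alt := hβ
  smooth := hψ
  unit := hu
  isotropic a ha b hb := (hA.2 a).1 ha b hb
  separates w hw := by
    rw [hA.2] at hw
    push Not at hw
    obtain ⟨a, ha, h⟩ := hw
    exact ⟨a, ha, (hu _).resolve_left h⟩
  ext := hχ

variable [IsTopologicalRing F] [IsModuleTopology F W] [FiniteDimensional F W]

/-- Let `L` be a subgroup on which the cocycle of the Heisenberg group is trivial, and `χ` a
character of `A_H` which is trivial on `A ∩ L`. Then `χ` extends to `L + (A ∩ L^⊥)`. -/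
theorem exists_extension (hβ : β.IsAlt) (h2 : (2 : F) ≠ 0) (hψ : IsLocallyConstant ψ)
    {A L : AddSubgroup W} (hLo : IsOpen (L : Set W)) (hL : ∀ l ∈ L, ∀ l' ∈ L, ψ (2⁻¹ * β l l') = 1)
    {χ : heisSub β A →* Rˣ} (hχ : IsSmoothExtension ψ χ)
    (hLA : ∀ a ∈ L, ∀ ha : a ∈ A, χ ⟨⟨a, 0⟩, ha⟩ = 1) :
    ∃ χL : heisSub β (L ⊔ (orthogonal β ψ L ⊓ A)) →* Rˣ, IsSmoothExtension ψ χL ∧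
      ∀ x (hx : x ∈ heisSub β A) (hx' : x ∈ heisSub β (L ⊔ (orthogonal β ψ L ⊓ A))),
        χL ⟨x, hx'⟩ = χ ⟨x, hx⟩ := by
  set P := orthogonal β ψ L ⊓ A with hP
  have hmem {l : W} {x : Heisenberg β} (hx : x.w - l ∈ P) :
      (⟨-l, 0⟩ : Heisenberg β) * x ∈ heisSub β A := by
    change -l + x.w ∈ A
    rw [neg_add_eq_sub]
    exact hx.2
  have htriv {a : W} {s : F} (ha : a ∈ L) (ha' : a ∈ A) (hs : ψ s = 1) :
      χ ⟨⟨a, s⟩, ha'⟩ = 1 := by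
    refine Units.ext ?_
    rw [hχ.apply_mk_zero, hLA a ha ha', hs, mul_one]
  -- The extension sends `x` to `χ ((-l, 0) x)`, where `l ∈ L` and `x.w - l ∈ P`. This one identity
  -- yields multiplicativity and, with `y = 1` and `l' = 0`, independence of `l`.
  have key (l l' l'' : W) (hl : l ∈ L) (hl' : l' ∈ L) (hl'' : l'' ∈ L) (x y : Heisenberg β)
      (hx : x.w - l ∈ P) (hy : y.w - l' ∈ P) (hxy : (x * y).w - l'' ∈ P) :
      χ ⟨_, hmem hxy⟩ = χ ⟨_, hmem hx⟩ * χ ⟨_, hmem hy⟩ := by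
    have hd : l + l' - l'' ∈ A := by
      have h := A.sub_mem (A.sub_mem hxy.2 hx.2) hy.2
      have h3 : (x * y).w - l'' - (x.w - l) - (y.w - l') = l + l' - l'' := by
        rw [Heisenberg.mul_w]; abel
      rwa [h3] at h
    have hs : ψ (2⁻¹ * β l l' + -(2⁻¹ * β l'' (l + l')) + -(β l' (x.w - l))) = 1 :=
      addChar_add_eq_one (addChar_add_eq_one (hL l hl l' hl')
        (addChar_neg_eq_one (hL l'' hl'' _ (L.add_mem hl hl')))) (addChar_neg_eq_one (hx.1 l' hl'))
    rw [← one_mul (χ ⟨_, hmem hx⟩), ← htriv (L.sub_mem (L.add_mem hl hl') hl'') hd hs, ← map_mul,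
      ← map_mul]
    congr 1
    refine Subtype.ext (Heisenberg.ext ?_ ?_)
    · change -l'' + (x.w + y.w) = l + l' - l'' + (-l + x.w) + (-l' + y.w)
      abel
    · change 0 + (x.t + y.t + 2⁻¹ * β x.w y.w) + 2⁻¹ * β (-l'') (x.w + y.w) =
        (2⁻¹ * β l l' + -(2⁻¹ * β l'' (l + l')) + -(β l' (x.w - l))) +
          (0 + x.t + 2⁻¹ * β (-l) x.w) + 2⁻¹ * β (l + l' - l'') (-l + x.w) +
          (0 + y.t + 2⁻¹ * β (-l') y.w) + 2⁻¹ * β (l + l' - l'' + (-l + x.w)) (-l' + y.w)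
      have h1 := hβ.neg_eq l l'
      have h3 := hβ.neg_eq x.w l'
      have h4 := hβ.neg_eq l l
      simp only [map_add, map_sub, map_neg, LinearMap.add_apply, LinearMap.sub_apply,
        LinearMap.neg_apply, hβ.self_eq_zero] at *
      rw [← h1, ← h3]
      field_simp
      ring
  have hdec (x : heisSub β (L ⊔ P)) : ∃ l ∈ L, x.1.w - l ∈ P := by
    obtain ⟨l, hl, a, ha, h⟩ := AddSubgroup.mem_sup.1 x.2
    exact ⟨l, hl, by rwa [← h, add_sub_cancel_left]⟩
  choose d hdL hdP using hdec
  let χL : heisSub β (L ⊔ P) →* Rˣ := MonoidHom.mk' (fun x => χ ⟨_, hmem (hdP x)⟩) fun x y =>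
    key _ _ _ (hdL x) (hdL y) (hdL (x * y)) x y (hdP x) (hdP y) (hdP (x * y))
  have hval (x : heisSub β (L ⊔ P)) (l : W) (hl : l ∈ L) (hlP : x.1.w - l ∈ P) :
      χL x = χ ⟨_, hmem hlP⟩ := by
    have h1 : (1 : Heisenberg β).w - 0 ∈ P := by
      rw [sub_zero, Heisenberg.one_w]
      exact P.zero_mem
    have h := key l 0 (d x) hl L.zero_mem (hdL x) x 1 hlP h1 (by rw [mul_one]; exact hdP x)
    have h3 : χ ⟨_, hmem h1⟩ = 1 := by
      rw [← map_one χ]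
      congr 1
      refine Subtype.ext ?_
      change (⟨-0, 0⟩ : Heisenberg β) * 1 = 1
      rw [mul_one, neg_zero]
      rfl
    rw [h3] at h
    rw [← h.trans (mul_one _)]
    change χ _ = χ _
    congr 2
    rw [mul_one]
  refine ⟨χL, ⟨?_, fun t => ?_⟩, fun x hx hx' => ?_⟩
  · have hU : {x : Heisenberg β | x.w ∈ L ∧ ψ x.t = 1} ∈ 𝓝 1 := by
      refine Filter.inter_mem ((hLo.preimage Heisenberg.continuous_w).mem_nhds L.zero_mem) ?_
      exact ((hψ.comp_continuous Heisenberg.continuous_t).isOpen_fiber 1).mem_nhds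
        (AddChar.map_zero_eq_one ψ)
    -- Near `1` the component `s.w` is in `L`, so `l = s.w` is allowed and only the central part
    -- `(0, s.t)` remains.
    refine isLocallyConstant_of_eq_one χL hU fun s hs => ?_
    have h0 : s.1.w - s.1.w ∈ P := by
      rw [sub_self]
      exact P.zero_mem
    rw [hval s s.1.w hs.1 h0, ← htriv L.zero_mem A.zero_mem hs.2]
    congr 1
    refine Subtype.ext (Heisenberg.ext (neg_add_cancel _) ?_)
    change 0 + s.1.t + 2⁻¹ * β (-s.1.w) s.1.w = s.1.t
    rw [map_neg, LinearMap.neg_apply, hβ.self_eq_zero, neg_zero, mul_zero, add_zero, zero_add]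
  · have h0 : (⟨0, t⟩ : Heisenberg β).w - 0 ∈ P := by
      rw [sub_zero]
      exact P.zero_mem
    rw [hval _ 0 L.zero_mem h0, ← hχ.2]
    congr 2
    refine Subtype.ext ?_
    change (⟨-0, 0⟩ : Heisenberg β) * ⟨0, t⟩ = ⟨0, t⟩
    rw [neg_zero, Heisenberg.mk_mul_mk_zero, zero_add]
  · have hdA : -d ⟨x, hx'⟩ ∈ A := by
      have h := A.sub_mem (hdP ⟨x, hx'⟩).2 hx
      have h3 : x.w - d ⟨x, hx'⟩ - x.w = -d ⟨x, hx'⟩ := by abel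
      rwa [h3] at h
    have h1 := htriv (s := 0) (L.neg_mem (hdL ⟨x, hx'⟩)) hdA (AddChar.map_zero_eq_one ψ)
    rw [← one_mul (χ ⟨x, hx⟩), ← h1, ← map_mul]
    rfl

variable {p : ℕ} [Fact p.Prime] [IsDomain R]

/-- Every self-dual subgroup `A` has a compact open companion `L`, with a smooth extension of `ψ`
to `L_H` which agrees with a given one to `A_H`. -/
theorem exists_open_isSelfDual (hF : IsFiniteOrLocalField F p) (h2 : (2 : F) ≠ 0) (hβ : β.IsAlt)
    (hβ' : β.Nondegenerate) (hψ : IsLocallyConstant ψ) (hψ1 : ψ ≠ 1) {A : AddSubgroup W}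
    (hA : IsSelfDual β ψ A) {χ : heisSub β A →* Rˣ} (hχ : IsSmoothExtension ψ χ) :
    ∃ (L : AddSubgroup W) (χL : heisSub β L →* Rˣ), IsOpen (L : Set W) ∧ IsCompact (L : Set W) ∧
      IsSelfDual β ψ L ∧ IsSmoothExtension ψ χL ∧
      ∀ x (hx : x ∈ heisSub β A) (hx' : x ∈ heisSub β L), χL ⟨x, hx'⟩ = χ ⟨x, hx⟩ := by
  have := IsModuleTopology.topologicalAddGroup F W
  have hb : Continuous (fun x : W × W => 2⁻¹ * β x.1 x.2) :=
    continuous_const.mul (IsModuleTopology.continuous_bilinear_of_finite_left β)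
  have hN : {x : W × W | ψ (2⁻¹ * β x.1 x.2) = 1} ∈ 𝓝 ((0, 0) : W × W) :=
    ((hψ.comp_continuous hb).isOpen_fiber 1).mem_nhds (by simp)
  obtain ⟨U₁, hU₁, U₂, hU₂, hU⟩ := mem_nhds_prod_iff.1 hN
  obtain ⟨U₃, hU₃, hU₃'⟩ := exists_nhds_eq_one hχ.1
  have hcont : Continuous (fun w : W => (⟨w, 0⟩ : Heisenberg β)) :=
    Heisenberg.continuous_iff.2 ⟨continuous_id, continuous_const⟩
  obtain ⟨L, hLo, hLc, hLU⟩ := hF.exists_addSubgroup_module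
    (Filter.inter_mem (Filter.inter_mem hU₁ hU₂) (hcont.tendsto 0 hU₃))
  have hL (l) (hl : l ∈ L) (l') (hl' : l' ∈ L) : ψ (2⁻¹ * β l l') = 1 :=
    hU (Set.mk_mem_prod (hLU hl).1.1 (hLU hl').1.2)
  have hL' : L ≤ orthogonal β ψ L := fun l' hl' l hl => by
    have h := addChar_add_eq_one (hL l hl l' hl') (hL l hl l' hl')
    rwa [← two_mul, mul_inv_cancel_left₀ h2] at h
  obtain ⟨χL, hχL, hχLA⟩ := exists_extension hβ h2 hψ hLo hL hχ
    fun a ha ha' => hU₃' ⟨⟨a, 0⟩, ha'⟩ (hLU ha).2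
  -- The group `M = L + (L^⊥ ∩ A)` is open since it contains `L`, and compact since it is closed and
  -- contained in `L^⊥`.
  have hMo : IsOpen ((L ⊔ (orthogonal β ψ L ⊓ A) : AddSubgroup W) : Set W) :=
    AddSubgroup.isOpen_mono le_sup_left hLo
  have hMc := AddSubgroup.isClosed_of_isOpen _ hMo
  have hML : L ⊔ (orthogonal β ψ L ⊓ A) ≤ orthogonal β ψ L := sup_le hL' inf_le_left
  obtain ⟨C, hC, hLC⟩ := hF.isCompact_orthogonal hβ' hψ1 hLo
  refine ⟨_, χL, hMo, hC.of_isClosed_subset hMc fun w hw => hLC w (hML hw),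
    ⟨hMc, fun w => ⟨fun hw b hb => ?_, fun hw => ?_⟩⟩, hχL, hχLA⟩
  · obtain ⟨l, hl, a, ha, rfl⟩ := AddSubgroup.mem_sup.1 hw
    obtain ⟨l', hl', a', ha', rfl⟩ := AddSubgroup.mem_sup.1 hb
    rw [map_add β, LinearMap.add_apply]
    refine addChar_add_eq_one (hML hb l hl) ?_
    rw [map_add]
    exact addChar_add_eq_one ((pairing_eq_one_comm hβ).1 (ha.1 l' hl')) ((hA.2 a).1 ha.2 a' ha'.2)
  -- If `w` is orthogonal to `M`, it is orthogonal to `A ∩ L^⊥`, hence `w = l + a` with `l ∈ L` and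
  -- `a ∈ A`. Then `a = w - l` lies in `L^⊥`, because `w` and `L` do.
  · obtain ⟨l, hl, hlA⟩ := exists_add_eq_of_orthogonal hψ hA hLc
      (hF.exists_nsmul_orthogonal hψ hLc)
      fun y hy hy' => hw y (AddSubgroup.mem_sup_right ⟨hy', hy⟩)
    refine AddSubgroup.mem_sup.2 ⟨l, hl, w - l, ⟨?_, hlA⟩, add_sub_cancel l w⟩
    refine (orthogonal β ψ L).sub_mem (fun l' hl' => ?_) (hL' hl)
    exact (pairing_eq_one_comm hβ).1 (hw l' (AddSubgroup.mem_sup_left hl'))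

/-- The space `V_A` contains an eigenvector of `L_H`, for `L` compact open. -/
theorem IsModel.exists_eigenvector (hβ' : β.Nondegenerate) (hψ1 : ψ ≠ 1) {A L : AddSubgroup W}
    {χ : heisSub β A →* Rˣ} {χL : heisSub β L →* Rˣ} (hA : IsModel β ψ χ)
    (hAc : IsClosed (A : Set W)) (hLo : IsOpen (L : Set W)) (hLc : IsCompact (L : Set W))
    (hχL : IsSmoothExtension ψ χL) :
    ∃ (v : Model χ) (x₀ : Heisenberg β), v.1 x₀ = 1 ∧
      ∀ s : heisSub β L, modelRep χ s v = (χL s : R) • v := by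
  obtain ⟨w₀, hw₀⟩ := exists_translation hA.alt hβ' hA.smooth hψ1 hAc hLc hA.ext hχL
  have hcont : Continuous (fun w : W => (⟨w, 0⟩ : Heisenberg β)) :=
    Heisenberg.continuous_iff.2 ⟨continuous_id, continuous_const⟩
  -- The eigenvector is supported on `A_H (w₀, 0) L_H`. Conjugation by `(w₀, 0)` multiplies `χ s` by
  -- `ψ (β w₀ s.w)`, which is exactly the discrepancy between `χ` and `χL`.
  obtain ⟨v, h1, h3, -⟩ := WeilRep.exists_eigenvector (isOpen_heisSub hLo) χ χL hχL.1 ⟨w₀, 0⟩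
    (C := (fun x => (⟨w₀, 0⟩ : Heisenberg β) * x) '' ((fun w : W => ⟨w, 0⟩) '' (L : Set W)))
    ((hLc.image hcont).image (continuous_const_mul _))
    (fun s hs => ⟨⟨0, s.t⟩, A.zero_mem, _, ⟨_, ⟨s.w, hs, rfl⟩, rfl⟩, by
      refine Heisenberg.ext (zero_add _).symm ?_
      change 0 + s.t + 2⁻¹ * β w₀ s.w =
        s.t + (0 + 0 + 2⁻¹ * β w₀ s.w) + 2⁻¹ * β 0 (w₀ + s.w)
      simp⟩)
    (fun a s h => by
      have h4 := congrArg Heisenberg.w h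
      have h5 := congrArg Heisenberg.t h
      change a.1.w + w₀ = w₀ + s.1.w at h4
      change a.1.t + 0 + 2⁻¹ * β a.1.w w₀ = 0 + s.1.t + 2⁻¹ * β w₀ s.1.w at h5
      rw [add_comm, add_right_inj] at h4
      have hsA : s.1.w ∈ A := h4 ▸ a.2
      have h6 := hw₀ s.1 hsA s.2
      refine Units.ext ?_
      rw [show s = ⟨s.1, s.2⟩ from rfl, h6]
      rw [show (χ ⟨s.1, hsA⟩ : R) * ψ (β w₀ s.1.w) = χ ⟨⟨s.1.w, s.1.t + β w₀ s.1.w⟩, hsA⟩ from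
        (hA.ext.apply_mk hsA _ _).symm]
      congr 2
      refine Subtype.ext (Heisenberg.ext h4 ?_)
      have h7 := hA.alt.neg_eq a.1.w w₀
      change a.1.t = s.1.t + β w₀ s.1.w
      rw [← h4] at h5 ⊢
      have h8 := hA.two_ne
      field_simp at h5
      rw [← h7] at h5 ⊢
      refine mul_left_cancel₀ h8 ?_
      linear_combination h5)
  exact ⟨v, ⟨w₀, 0⟩, h1, h3⟩

end OpenModel

/-! ### Fiber products as central extensions. -/

section Extension

variable {R V G : Type*} [CommRing R] [AddCommGroup V] [Module R V] [Group G]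

theorem red_eq_one_iff {M : V ≃ₗ[R] V} : red R V M = 1 ↔ ∃ c, scalars R V c = M :=
  QuotientGroup.eq_one_iff M

theorem isCentralExtension_fiberProd (hinj : Function.Injective (scalars R V)) (σ : G →* PGL R V) :
    IsCentralExtension (fiberProd.incl σ) (fiberProd.proj σ) := by
  have hincl (c) : (fiberProd.incl σ c).1 = (1, scalars R V c) := rfl
  refine ⟨⟨⟨fiberProd.incl σ, fiberProd.proj σ, ?_, ?_, ?_⟩, rfl, rfl⟩, ?_⟩
  · intro c d h
    have := congrArg (fun x => x.1.2) h
    exact hinj this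
  · ext x
    constructor
    · rintro ⟨c, rfl⟩
      rfl
    · intro hx
      have hx1 : x.1.1 = 1 := hx
      have hx2 : σ x.1.1 = red R V x.1.2 := x.2
      rw [hx1, map_one, eq_comm, red_eq_one_iff] at hx2
      obtain ⟨c, hc⟩ := hx2
      exact ⟨c, Subtype.ext (Prod.ext hx1.symm hc)⟩
  · intro g
    obtain ⟨M, hM⟩ := QuotientGroup.mk'_surjective (scalars R V).range (σ g)
    exact ⟨⟨(g, M), hM.symm⟩, rfl⟩
  · rintro _ ⟨c, rfl⟩
    rw [Subgroup.mem_center_iff]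
    intro x
    refine Subtype.ext (Prod.ext ((mul_one _).trans (one_mul _).symm) ?_)
    ext v
    exact map_smul x.1.2 (c : R) v

end Extension

/-! ### Intertwiners and the projective Weil representation. -/

section Projective

variable {F W : Type*} [Field F] [AddCommGroup W] [Module F W]
  {β : LinearMap.BilinForm F W} {R : Type*} [CommRing R] {ψ : AddChar F R}
  [TopologicalSpace F] [TopologicalSpace W]
  {A A' : AddSubgroup W} {χ : heisSub β A →* Rˣ} {χ' : heisSub β A' →* Rˣ}

theorem scalars_injective {e : Model χ} (he : e.1 1 = 1) :
    Function.Injective (scalars R (Model χ)) := by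
  intro c d h
  have h1 : ((c : R) • e).1 1 = ((d : R) • e).1 1 :=
    congrArg (fun f : Model χ => f.1 1) (LinearEquiv.congr_fun h e)
  change (c : R) * e.1 1 = (d : R) * e.1 1 at h1
  rw [he, mul_one, mul_one] at h1
  exact Units.ext h1

variable [IsModuleTopology F W]

theorem translate_isSelfDual {ψ : AddChar F R} (g : Sp β) (hA : IsSelfDual β ψ A) :
    IsSelfDual β ψ (translate g A) := by
  have hmem (w : W) : w ∈ translate g A ↔ g.1.symm w ∈ A := by
    constructor
    · rintro ⟨a, ha, rfl⟩
      change g.1.symm (g.1 a) ∈ A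
      rwa [LinearEquiv.symm_apply_apply]
    · intro h
      exact ⟨_, h, g.1.apply_symm_apply w⟩
  have := IsModuleTopology.toContinuousAdd F W
  refine ⟨?_, fun w => ?_⟩
  · have h : ((translate g A : AddSubgroup W) : Set W) = g.1.symm ⁻¹' A := Set.ext hmem
    rw [h]
    exact hA.1.preimage (IsModuleTopology.continuous_of_linearMap g.1.symm.toLinearMap)
  · rw [hmem, hA.2]
    have hg (a : W) : β (g.1.symm w) a = β w (g.1 a) := by
      rw [← g.2 (g.1.symm w) a, LinearEquiv.apply_symm_apply]
    constructor
    · rintro h _ ⟨a, ha, rfl⟩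
      rw [← h a ha, hg]
      rfl
    · intro h a ha
      rw [hg]
      exact h _ ⟨a, ha, rfl⟩

variable [IsTopologicalRing F]

theorem translateChar_isSmoothExtension {ψ : AddChar F R} (g : Sp β)
    (hχ : IsSmoothExtension ψ χ) : IsSmoothExtension ψ (translateChar g χ) := by
  refine ⟨hχ.1.comp_continuous (f := fun x : heisSub β (translate g A) =>
    (⟨heisAct g⁻¹ x, heisAct_inv_mem g x.2⟩ : heisSub β A)) (Continuous.subtype_mk
      ((continuous_heisAct g⁻¹).comp continuous_subtype_val) _), fun t => ?_⟩
  rw [← hχ.2 t]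
  change ((χ _ : Rˣ) : R) = _
  congr 2
  exact Subtype.ext (Heisenberg.ext (map_zero (g⁻¹ : Sp β).1) rfl)

variable [FiniteDimensional F W]

/-- `M ρ(h) M⁻¹ = ρ(g • h)` for all `h` in the Heisenberg group. -/
def Intertwines (g : Sp β) (M : Model χ ≃ₗ[R] Model χ) : Prop :=
  ∀ h f, M (modelRep χ h f) = modelRep χ (heisAct g h) (M f)

theorem transport_modelRep (g : Sp β) (h : Heisenberg β) (f : Model χ) :
    transport g χ (modelRep χ h f) =
      modelRep (translateChar g χ) (heisAct g h) (transport g χ f) := by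
  ext x
  change f.1 (heisAct g⁻¹ x * h) = f.1 (heisAct g⁻¹ (x * heisAct g h))
  rw [map_mul, heisAct_inv_heisAct]

theorem intertwines_transport (g : Sp β)
    (J : (modelRep (translateChar g χ)).Equiv (modelRep χ)) :
    Intertwines g ((transport g χ).trans J.toLinearEquiv) := by
  intro h f
  change J (transport g χ (modelRep χ h f)) = modelRep χ (heisAct g h) (J (transport g χ f))
  rw [transport_modelRep]
  exact LinearMap.congr_fun (J.isIntertwining' (heisAct g h)) _

theorem Intertwines.exists_equiv {g : Sp β} {M : Model χ ≃ₗ[R] Model χ} (hM : Intertwines g M) :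
    ∃ J : (modelRep (translateChar g χ)).Equiv (modelRep χ),
      M = (transport g χ).trans J.toLinearEquiv := by
  refine ⟨.mk ((transport g χ).symm.trans M) fun h => LinearMap.ext fun f => ?_, ?_⟩
  · obtain ⟨f, rfl⟩ := (transport g χ).surjective f
    change M ((transport g χ).symm (modelRep (translateChar g χ) h (transport g χ f))) =
      modelRep χ h (M ((transport g χ).symm (transport g χ f)))
    conv_lhs => rw [← heisAct_heisAct_inv g h]
    rw [← transport_modelRep, LinearEquiv.symm_apply_apply, LinearEquiv.symm_apply_apply, hM,
      heisAct_heisAct_inv]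
  · ext f : 1
    change M f = M ((transport g χ).symm (transport g χ f))
    rw [LinearEquiv.symm_apply_apply]

theorem Intertwines.mul {g g' : Sp β} {M M' : Model χ ≃ₗ[R] Model χ} (hM : Intertwines g M)
    (hM' : Intertwines g' M') : Intertwines (g * g') (M * M') := by
  intro h f
  change M (M' _) = modelRep χ (heisAct g (heisAct g' h)) (M (M' f))
  rw [hM', hM]

theorem Intertwines.scalars_mul {g : Sp β} {M : Model χ ≃ₗ[R] Model χ} (hM : Intertwines g M)
    (c : Rˣ) : Intertwines g (M * scalars R (Model χ) c) := by
  intro h f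
  change M ((c : R) • modelRep χ h f) = modelRep χ (heisAct g h) (M ((c : R) • f))
  rw [map_smul, map_smul, map_smul, hM]

theorem Intertwines.conj {g : Sp β} {M : Model χ ≃ₗ[R] Model χ} (hM : Intertwines g M)
    (Φ : (modelRep χ).Equiv (modelRep χ')) :
    Intertwines g (Φ.toLinearEquiv.symm.trans (M.trans Φ.toLinearEquiv)) := by
  intro h f
  have h1 (h f) : Φ (modelRep χ h f) = modelRep χ' h (Φ f) :=
    LinearMap.congr_fun (Φ.isIntertwining' h) f
  have h2 : Φ.symm (modelRep χ' h f) = modelRep χ h (Φ.symm f) :=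
    LinearMap.congr_fun (Φ.symm.isIntertwining' h) f
  change Φ (M (Φ.symm (modelRep χ' h f))) = modelRep χ' (heisAct g h) (Φ (M (Φ.symm f)))
  rw [h2, hM, h1]

/-- This describes the fiber product without reference to `gA` or to a choice of `J`, in a form
visibly stable under conjugation by isomorphisms of models. -/
theorem IsProjectiveWeil.eq_red_iff {σ : Sp β →* PGL R (Model χ)} (hσ : IsProjectiveWeil χ σ)
    {g : Sp β} {M : Model χ ≃ₗ[R] Model χ} : σ g = red R (Model χ) M ↔ Intertwines g M := by
  constructor
  · intro h
    obtain ⟨J, hJ⟩ : σ g ∈ {P : PGL R (Model χ) |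
        ∃ J : (modelRep (translateChar g χ)).Equiv (modelRep χ),
          P = red R (Model χ) ((transport g χ).trans J.toLinearEquiv)} := by
      rw [hσ g]; rfl
    obtain ⟨c, hc⟩ := QuotientGroup.eq.1 (hJ.symm.trans h)
    rw [eq_inv_mul_iff_mul_eq] at hc
    rw [← hc]
    exact (intertwines_transport g J).scalars_mul c
  · intro h
    obtain ⟨J, hJ⟩ := h.exists_equiv
    have : red R (Model χ) M ∈ {P : PGL R (Model χ) |
        ∃ J : (modelRep (translateChar g χ)).Equiv (modelRep χ),
          P = red R (Model χ) ((transport g χ).trans J.toLinearEquiv)} := ⟨J, by rw [← hJ]⟩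
    rw [hσ g] at this
    exact this.symm

theorem IsModel.exists_scalars_eq (hm : IsModel β ψ χ) {e : Model χ} (he : e.1 1 = 1)
    (T : Model χ ≃ₗ[R] Model χ) (hT : ∀ h f, T (modelRep χ h f) = modelRep χ h (T f)) :
    ∃ c, scalars R (Model χ) c = T := by
  obtain ⟨c, hc⟩ := hm.exists_eq_smul (T := T.toLinearMap) hT he
  obtain ⟨d, hd⟩ := hm.exists_eq_smul (T := T.symm.toLinearMap) (fun h f => by
    refine T.injective ?_
    change T (T.symm (modelRep χ h f)) = T (modelRep χ h (T.symm f))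
    rw [hT, LinearEquiv.apply_symm_apply, LinearEquiv.apply_symm_apply]) he
  have hc (f) : T f = c • f := hc f
  have hd (f) : T.symm f = d • f := hd f
  have h1 := congrArg (fun f : Model χ => f.1 1) (T.apply_symm_apply e)
  rw [hd, hc] at h1
  change c * (d * e.1 1) = e.1 1 at h1
  rw [he, mul_one] at h1
  refine ⟨Units.mkOfMulEqOne c d h1, ?_⟩
  ext f : 1
  exact (hc f).symm

theorem IsModel.red_eq_red (hm : IsModel β ψ χ) {e : Model χ} (he : e.1 1 = 1) {g : Sp β}
    {M M' : Model χ ≃ₗ[R] Model χ} (hM : Intertwines g M) (hM' : Intertwines g M') :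
    red R (Model χ) M = red R (Model χ) M' := by
  refine QuotientGroup.eq.2 (hm.exists_scalars_eq he _ fun h f => ?_)
  refine M.injective ?_
  change M (M.symm (M' (modelRep χ h f))) = M (modelRep χ h (M.symm (M' f)))
  rw [hM, LinearEquiv.apply_symm_apply, LinearEquiv.apply_symm_apply, hM']

/-- By Schur's lemma all intertwiners for a given `g` have the same class, and a product of
intertwiners for `g` and `g'` is one for `g * g'`; so any choice of `J` gives the same morphism. -/
theorem IsModel.existsUnique_isProjectiveWeil (hm : IsModel β ψ χ) {e : Model χ} (he : e.1 1 = 1)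
    (hJ : ∀ g : Sp β, Nonempty ((modelRep (translateChar g χ)).Equiv (modelRep χ))) :
    ∃! σ, IsProjectiveWeil χ σ := by
  let J g := (hJ g).some
  have hJ' (g) := intertwines_transport g (J g)
  let σ : Sp β →* PGL R (Model χ) :=
    MonoidHom.mk' (fun g => red R (Model χ) ((transport g χ).trans (J g).toLinearEquiv))
      fun g g' => by
        rw [← map_mul]
        exact hm.red_eq_red he (hJ' _) ((hJ' g).mul (hJ' g'))
  have hσ : IsProjectiveWeil χ σ := by
    intro g
    ext P
    constructor
    · rintro ⟨J', rfl⟩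
      exact hm.red_eq_red he (intertwines_transport g J') (hJ' g)
    · rintro rfl
      exact ⟨J g, rfl⟩
  refine ⟨σ, hσ, fun σ' hσ' => MonoidHom.ext fun g => ?_⟩
  exact Set.singleton_injective ((hσ' g).symm.trans (hσ g))

/-- Conjugation by an isomorphism of models, from one metaplectic group to the other. -/
def mpEquiv {σ : Sp β →* PGL R (Model χ)} {σ' : Sp β →* PGL R (Model χ')}
    (hσ : IsProjectiveWeil χ σ) (hσ' : IsProjectiveWeil χ' σ')
    (Φ : (modelRep χ).Equiv (modelRep χ')) : Mp σ ≃* Mp σ' where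
  toFun x := ⟨(x.1.1, Φ.toLinearEquiv.symm.trans (x.1.2.trans Φ.toLinearEquiv)),
    hσ'.eq_red_iff.2 ((hσ.eq_red_iff.1 x.2).conj Φ)⟩
  invFun x := ⟨(x.1.1, Φ.symm.toLinearEquiv.symm.trans (x.1.2.trans Φ.symm.toLinearEquiv)),
    hσ.eq_red_iff.2 ((hσ'.eq_red_iff.1 x.2).conj Φ.symm)⟩
  left_inv x := by
    refine Subtype.ext (Prod.ext rfl ?_)
    ext f : 1
    change Φ.symm (Φ (x.1.2 (Φ.symm (Φ f)))) = x.1.2 f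
    rw [Representation.Equiv.symm_apply_apply, Representation.Equiv.symm_apply_apply]
  right_inv x := by
    refine Subtype.ext (Prod.ext rfl ?_)
    ext f : 1
    change Φ (Φ.symm (x.1.2 (Φ (Φ.symm f)))) = x.1.2 f
    rw [Representation.Equiv.apply_symm_apply, Representation.Equiv.apply_symm_apply]
  map_mul' x y := by
    refine Subtype.ext (Prod.ext rfl ?_)
    ext f : 1
    change Φ (x.1.2 (y.1.2 (Φ.symm f))) = Φ (x.1.2 (Φ.symm (Φ (y.1.2 (Φ.symm f)))))
    rw [Representation.Equiv.symm_apply_apply]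

end Projective

/-! ### Comparison of the Weil representations of two self-dual subgroups. -/

section Main

variable {F W : Type*} [Field F] [AddCommGroup W] [Module F W]
  {β : LinearMap.BilinForm F W} {R : Type*} [CommRing R] {ψ : AddChar F R}
  [TopologicalSpace F] [TopologicalSpace W]
  [IsTopologicalRing F] [FiniteDimensional F W] [IsModuleTopology F W]
  {A A' : AddSubgroup W} {χ : heisSub β A →* Rˣ} {χ' : heisSub β A' →* Rˣ}
  {p : ℕ} [Fact p.Prime]

/-- By Schur's lemma over the base ring, `Φ` is a unit multiple of one isomorphism `Φ₀` already
known to extend, so it extends as well. Uniqueness needs only the surjectivity of `scalarExt` for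
the source. -/
theorem exists_equiv_iff_comp_scalarExt (B : Type*) [CommRing B] [Algebra R B]
    {e : Model χ} (he : e.1 1 = 1) (hm : IsModel β ψ χ)
    {Φ₀ : (modelRep χ).Equiv (modelRep χ')}
    {ΦB₀ : (modelRep (charExt B χ)).Equiv (modelRep (charExt B χ'))}
    (h₀ : ∀ f, ΦB₀ (extend B χ f) = extend B χ' (Φ₀ f)) (Φ : (modelRep χ).Equiv (modelRep χ')) :
    ∃ ΦB : (modelRep (charExt B χ)).Equiv (modelRep (charExt B χ')),
      ∀ T : Model (charExt B χ) →ₗ[B] Model (charExt B χ'),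
        T ∘ₗ scalarExt _ χ B = scalarExt _ χ' B ∘ₗ LinearMap.baseChange B Φ.toLinearMap ↔
          T = ΦB.toLinearMap := by
  obtain ⟨c, hc⟩ := hm.exists_scalars_eq he (Φ.trans Φ₀.symm).toLinearEquiv
    fun h f => LinearMap.congr_fun ((Φ.trans Φ₀.symm).isIntertwining' h) f
  have hΦ (f) : Φ f = (c : R) • Φ₀ f := by
    have h1 : (c : R) • f = Φ₀.symm (Φ f) := LinearEquiv.congr_fun hc f
    rw [← map_smul, h1, Representation.Equiv.apply_symm_apply]
  let u : Bˣ := Units.map (algebraMap R B : R →* B) c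
  let ΦB : (modelRep (charExt B χ)).Equiv (modelRep (charExt B χ')) :=
    .mk ((scalars B _ u).trans ΦB₀.toLinearEquiv) fun h => LinearMap.ext fun f => by
      change ΦB₀ ((u : B) • modelRep (charExt B χ) h f) =
        modelRep (charExt B χ') h (ΦB₀ ((u : B) • f))
      rw [map_smul, map_smul, map_smul]
      congr 1
      exact LinearMap.congr_fun (ΦB₀.isIntertwining' h) f
  have hΦB (f) : ΦB f = (u : B) • ΦB₀ f := map_smul ΦB₀ (u : B) f
  have key (z) : ΦB (scalarExt _ χ B z) =
      scalarExt _ χ' B (LinearMap.baseChange B Φ.toLinearMap z) := by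
    induction z with
    | zero => simp only [map_zero]
    | add x y hx hy => simp only [map_add, hx, hy]
    | tmul b f =>
      rw [scalarExt_tmul, LinearMap.baseChange_tmul, scalarExt_tmul, map_smul, hΦB, h₀]
      change _ = b • extend B χ' (Φ f)
      rw [hΦ, extend_smul]
      rfl
  refine ⟨ΦB, fun T => ⟨fun hT => LinearMap.ext fun f => ?_, ?_⟩⟩
  · obtain ⟨z, rfl⟩ := hm.scalarExt_surjective B he f
    exact (LinearMap.congr_fun hT z).trans (key z).symm
  · rintro rfl
    exact LinearMap.ext key

theorem exists_mpEquiv {σ : Sp β →* PGL R (Model χ)} {σ' : Sp β →* PGL R (Model χ')}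
    (hσ : IsProjectiveWeil χ σ) (hσ' : IsProjectiveWeil χ' σ')
    (Φ : (modelRep χ).Equiv (modelRep χ')) :
    ∃ e : Mp σ ≃* Mp σ',
      (∀ x, (e x).1 = (x.1.1, Φ.toLinearEquiv.symm.trans (x.1.2.trans Φ.toLinearEquiv))) ∧
      (∀ c, e (fiberProd.incl σ c) = fiberProd.incl σ' c) ∧
      (∀ x, fiberProd.proj σ' (e x) = fiberProd.proj σ x) ∧
      (∀ x v, Φ (weil σ x (Φ.symm v)) = weil σ' (e x) v) := by
  refine ⟨mpEquiv hσ hσ' Φ, fun x => rfl, fun c => ?_, fun x => rfl, fun x v => rfl⟩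
  refine Subtype.ext (Prod.ext rfl ?_)
  ext f : 1
  change Φ ((c : R) • Φ.symm f) = (c : R) • f
  rw [map_smul, Representation.Equiv.apply_symm_apply]

variable [IsDomain R]

/-- A function with value `1` normalizes Schur's lemma, makes the scalars act faithfully, and keeps
its value after extension of scalars. Since `χ` and `χL` agree on the intersection of `A_H` and
`L_H`, it can be supported on `A_H L_H`. -/
theorem exists_apply_one_eq_one (hF : IsFiniteOrLocalField F p) (h2 : (2 : F) ≠ 0) (hβ : β.IsAlt)
    (hβ' : β.Nondegenerate) (hψ : IsLocallyConstant ψ) (hψ1 : ψ ≠ 1)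
    (hA : IsSelfDual β ψ A) (hχ : IsSmoothExtension ψ χ) : ∃ e : Model χ, e.1 1 = 1 := by
  obtain ⟨L, χL, hLo, hLc, -, hχL, h⟩ := exists_open_isSelfDual hF h2 hβ hβ' hψ hψ1 hA hχ
  have hcont : Continuous (fun w : W => (⟨w, 0⟩ : Heisenberg β)) :=
    Heisenberg.continuous_iff.2 ⟨continuous_id, continuous_const⟩
  obtain ⟨v, hv, -⟩ := exists_eigenvector (isOpen_heisSub hLo) χ χL hχL.1 1 (hLc.image hcont)
    (fun s hs => ⟨⟨0, s.t⟩, A.zero_mem, ⟨s.w, 0⟩, ⟨s.w, hs, rfl⟩, by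
      rw [one_mul, Heisenberg.mk_zero_mul_mk, add_zero]⟩)
    (fun a s has => by
      rw [mul_one, one_mul] at has
      have hs : (s : Heisenberg β) ∈ heisSub β A := has ▸ a.2
      rw [show s = ⟨s.1, s.2⟩ from rfl, h s hs s.2]
      congr 1
      exact Subtype.ext has)
  exact ⟨v, hv⟩

/-- Any two models are isomorphic, compatibly with extension of scalars. -/
theorem exists_equiv (B : Type*) [CommRing B] [Algebra R B] (hF : IsFiniteOrLocalField F p)
    (hp : IsUnit (p : R)) (h2 : (2 : F) ≠ 0) (hβ : β.IsAlt)
    (hβ' : β.Nondegenerate) (hψ : IsLocallyConstant ψ) (hψ1 : ψ ≠ 1)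
    (hA : IsSelfDual β ψ A) (hχ : IsSmoothExtension ψ χ)
    (hA' : IsSelfDual β ψ A') (hχ' : IsSmoothExtension ψ χ') :
    ∃ (Φ : (modelRep χ).Equiv (modelRep χ'))
      (ΦB : (modelRep (charExt B χ)).Equiv (modelRep (charExt B χ'))),
      ∀ f, ΦB (extend B χ f) = extend B χ' (Φ f) := by
  have hu := hF.isUnit_sub_one hp hψ
  -- The subgroup `L` built from `A` serves for `A'` too: its agreement with `χ` plays no role here,
  -- since `IsModel.exists_eigenvector` corrects by a translation.
  obtain ⟨L, χL, hLo, hLc, hL, hχL, -⟩ := exists_open_isSelfDual hF h2 hβ hβ' hψ hψ1 hA hχ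
  have hmL := IsModel.of_isSelfDual h2 hβ hψ hu hL hχL
  have hm := IsModel.of_isSelfDual h2 hβ hψ hu hA hχ
  have hm' := IsModel.of_isSelfDual h2 hβ hψ hu hA' hχ'
  obtain ⟨v, x, hvx, hv⟩ := hm.exists_eigenvector hβ' hψ1 hA.1 hLo hLc hχL
  obtain ⟨v', x', hvx', hv'⟩ := hm'.exists_eigenvector hβ' hψ1 hA'.1 hLo hLc hχL
  obtain ⟨Φ, ΦB, h⟩ := hmL.exists_equiv_of_isOpen B hLo hm hv hvx
  obtain ⟨Φ', ΦB', h'⟩ := hmL.exists_equiv_of_isOpen B hLo hm' hv' hvx'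
  refine ⟨Φ.symm.trans Φ', ΦB.symm.trans ΦB', fun f => ?_⟩
  rw [Representation.Equiv.trans_apply, Representation.Equiv.trans_apply, ← h']
  congr 1
  rw [← Representation.Equiv.symm_apply_apply ΦB (extend B χL (Φ.symm f)), h,
    Representation.Equiv.apply_symm_apply]

theorem existsUnique_isProjectiveWeil (B : Type*) [CommRing B] [Algebra R B]
    (hF : IsFiniteOrLocalField F p) (hp : IsUnit (p : R)) (h2 : (2 : F) ≠ 0) (hβ : β.IsAlt)
    (hβ' : β.Nondegenerate) (hψ : IsLocallyConstant ψ) (hψ1 : ψ ≠ 1)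
    (hA : IsSelfDual β ψ A) (hχ : IsSmoothExtension ψ χ) :
    ∃! σ, IsProjectiveWeil (charExt B χ) σ := by
  obtain ⟨e, he⟩ := exists_apply_one_eq_one hF h2 hβ hβ' hψ hψ1 hA hχ
  have hm := IsModel.of_isSelfDual h2 hβ hψ (hF.isUnit_sub_one hp hψ) hA hχ
  refine (hm.baseChange B).existsUnique_isProjectiveWeil (e := extend B χ e)
    (by rw [extend_apply, he, map_one]) fun g => ?_
  -- The isomorphism `J` over `B` comes from comparing `gA` with `A` over the base ring; translating
  -- a character by `g` commutes with extending its scalars by definition.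
  obtain ⟨-, ΦB, -⟩ := exists_equiv B hF hp h2 hβ hβ' hψ hψ1
    (translate_isSelfDual g hA) (translateChar_isSmoothExtension g hχ) hA hχ
  exact ⟨ΦB⟩

theorem isCentralExtension_mp (B : Type*) [CommRing B] [Algebra R B]
    (hF : IsFiniteOrLocalField F p) (h2 : (2 : F) ≠ 0) (hβ : β.IsAlt)
    (hβ' : β.Nondegenerate) (hψ : IsLocallyConstant ψ) (hψ1 : ψ ≠ 1)
    (hA : IsSelfDual β ψ A) (hχ : IsSmoothExtension ψ χ)
    (σ : Sp β →* PGL B (Model (charExt B χ))) :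
    IsCentralExtension (fiberProd.incl σ) (fiberProd.proj σ) := by
  obtain ⟨e, he⟩ := exists_apply_one_eq_one hF h2 hβ hβ' hψ hψ1 hA hχ
  exact isCentralExtension_fiberProd (scalars_injective (e := extend B χ e)
    (by rw [extend_apply, he, map_one])) σ

end Main

end WeilRep

end

set_option maxHeartbeats 1000000 in
theorem mainTheorem9
    {F : Type*} [Field F] [TopologicalSpace F] [IsTopologicalRing F]
    {p : ℕ} [Fact p.Prime] (hF : WeilRep.IsFiniteOrLocalField F p) (hF2 : (2 : F) ≠ 0)
    {K : Type*} [Field K] [Algebra ℚ K]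
    [IsCyclotomicExtension (WeilRep.rootOrders F p) ℚ K]
    {W : Type*} [AddCommGroup W] [Module F W] [FiniteDimensional F W]
    [TopologicalSpace W] [IsModuleTopology F W]
    (β : LinearMap.BilinForm F W) (hβ : β.IsAlt) (hβ' : β.Nondegenerate)
    (ψ : AddChar F (WeilRep.coeffRing K p)) (hψ : IsLocallyConstant ψ) (hψ1 : ψ ≠ 1)
    {B : Type*} [CommRing B] [Algebra (WeilRep.coeffRing K p) B]
    (A A' : AddSubgroup W) (hA : WeilRep.IsSelfDual β ψ A) (hA' : WeilRep.IsSelfDual β ψ A')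
    (ψA : WeilRep.heisSub β A →* (WeilRep.coeffRing K p)ˣ)
    (ψA' : WeilRep.heisSub β A' →* (WeilRep.coeffRing K p)ˣ)
    (hψA : WeilRep.IsSmoothExtension ψ ψA) (hψA' : WeilRep.IsSmoothExtension ψ ψA') :
    -- the projective Weil representations attached to `A` and `A'` over `B` are well defined
    (∃! σ, WeilRep.IsProjectiveWeil (WeilRep.charExt B ψA) σ) ∧
    (∃! σ', WeilRep.IsProjectiveWeil (WeilRep.charExt B ψA') σ') ∧
    -- there is an isomorphism of `H`-modules over the base ring
    Nonempty ((WeilRep.modelRep ψA).Equiv (WeilRep.modelRep ψA')) ∧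
    -- the scalar extension to `B` of such an isomorphism is an isomorphism of `H`-modules
    (∀ Φ : (WeilRep.modelRep ψA).Equiv (WeilRep.modelRep ψA'),
      ∃ ΦB : (WeilRep.modelRep (WeilRep.charExt B ψA)).Equiv
          (WeilRep.modelRep (WeilRep.charExt B ψA')),
        ∀ T : WeilRep.Model (WeilRep.charExt B ψA) →ₗ[B] WeilRep.Model (WeilRep.charExt B ψA'),
          T ∘ₗ WeilRep.scalarExt _ ψA B =
              WeilRep.scalarExt _ ψA' B ∘ₗ LinearMap.baseChange B Φ.toLinearMap ↔
            T = ΦB.toLinearMap) ∧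
    -- every isomorphism of `H`-modules over `B` identifies the two metaplectic central
    -- extensions by conjugation, compatibly with the Weil representations
    (∀ (σ : WeilRep.Sp β →* WeilRep.PGL B (WeilRep.Model (WeilRep.charExt B ψA)))
      (σ' : WeilRep.Sp β →* WeilRep.PGL B (WeilRep.Model (WeilRep.charExt B ψA'))),
      WeilRep.IsProjectiveWeil _ σ → WeilRep.IsProjectiveWeil _ σ' →
      WeilRep.IsCentralExtension (WeilRep.fiberProd.incl σ) (WeilRep.fiberProd.proj σ) ∧
      WeilRep.IsCentralExtension (WeilRep.fiberProd.incl σ') (WeilRep.fiberProd.proj σ') ∧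
      ∀ Φ' : (WeilRep.modelRep (WeilRep.charExt B ψA)).Equiv
          (WeilRep.modelRep (WeilRep.charExt B ψA')),
        ∃ e : WeilRep.Mp σ ≃* WeilRep.Mp σ',
          (∀ x, (e x).1 =
            (x.1.1, Φ'.toLinearEquiv.symm.trans (x.1.2.trans Φ'.toLinearEquiv))) ∧
          (∀ c, e (WeilRep.fiberProd.incl σ c) = WeilRep.fiberProd.incl σ' c) ∧
          (∀ x, WeilRep.fiberProd.proj σ' (e x) = WeilRep.fiberProd.proj σ x) ∧
          (∀ x v, Φ' (WeilRep.weil σ x (Φ'.symm v)) = WeilRep.weil σ' (e x) v)) := by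
  have := algebraRat.charZero K
  have hp : IsUnit (p : WeilRep.coeffRing K p) :=
    WeilRep.isUnit_natCast_coeffRing K (Fact.out (p := p.Prime)).ne_zero
  have hm := WeilRep.IsModel.of_isSelfDual hF2 hβ hψ (hF.isUnit_sub_one hp hψ) hA hψA
  obtain ⟨e, he⟩ := WeilRep.exists_apply_one_eq_one hF hF2 hβ hβ' hψ hψ1 hA hψA
  obtain ⟨Φ₀, ΦB₀, h₀⟩ := WeilRep.exists_equiv B hF hp hF2 hβ hβ' hψ hψ1 hA hψA hA' hψA'
  exact ⟨WeilRep.existsUnique_isProjectiveWeil B hF hp hF2 hβ hβ' hψ hψ1 hA hψA,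
    WeilRep.existsUnique_isProjectiveWeil B hF hp hF2 hβ hβ' hψ hψ1 hA' hψA', ⟨Φ₀⟩,
    WeilRep.exists_equiv_iff_comp_scalarExt B he hm h₀, fun σ σ' hσ hσ' =>
    ⟨WeilRep.isCentralExtension_mp B hF hF2 hβ hβ' hψ hψ1 hA hψA σ,
      WeilRep.isCentralExtension_mp B hF hF2 hβ hβ' hψ hψ1 hA' hψA' σ',
      WeilRep.exists_mpEquiv hσ hσ'⟩⟩
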